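/- Let $M$ be an $n$-dimensional smooth manifold, let $I\subset\mathbb R$ be a nondegenerate interval (open, closed or half-open) and let $(g_t)_{t\in I}$ be a smooth 1-parameter family of semi-Riemannian metrics on $M$. Let $\mathcal Z=I\times M$ be the generalized cylinder, with metric $g^{\mathcal Z}=\langle\cdot,\cdot\rangle=dt^2+g_t$ (if $I$ contains an end point, $\mathcal Z$ has boundary and $t$-derivatives there are one-sided). Put $\nu=\partial/\partial t$, $M_t=\{t\}\times M$ with the metric $g_t$, and let $W(X)=-\nabla^{\mathcal Z}_X\nu$, $X\in TM_t$, be the Weingarten map of $M_t$. For $X,Y\in T_pM$ let $\dot g_t(X,Y)=\frac{d}{dt}\bigl(g_t(X,Y)\bigr)$ and $\ddot g_t(X,Y)=\frac{d^2}{dt^2}\bigl(g_t(X,Y)\bigr)$. The conventions are $R(X,Y)Z=\nabla_X\nabla_YZ-\nabla_Y\nabla_XZ-\nabla_{[X,Y]}Z$, $\operatorname{ric}(X,Y)=\operatorname{tr}\bigl(Z\mapsto R(Z,X)Y\bigr)$, $\operatorname{Scal}=\operatorname{tr}_g(\operatorname{ric})$, and, for a $g_t$-orthonormal basis $(e_i)$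 of $T_pM$ with $\varepsilon_i=g_t(e_i,e_i)=\pm1$, $\operatorname{tr}_{g_t}(h)=\sum_i\varepsilon_i\,h(e_i,e_i)$ and $\operatorname{div}^{M_t}(W)=\sum_i\varepsilon_i\,(\nabla^{M_t}_{e_i}W)(e_i)$. Then $W$ maps $TM_t$ to $TM_t$, $\operatorname{tr}(W)$ is differentiable on $M_t$, and for all $t\in I$, $p\in M$ and $X,Y,U,V\in T_pM$ (regarded as tangent to $M_t$): \begin{align*} \langle W(X),Y\rangle &= -\tfrac12\,\dot g_t(X,Y),\\ \langle R^{\mathcal Z}(U,V)X,Y\rangle &= \langle R^{M_t}(U,V)X,Y\rangle+\tfrac14\bigl(\dot g_t(U,X)\,\dot g_t(V,Y)-\dot g_t(U,Y)\,\dot g_t(V,X)\bigr),\\ \langle R^{\mathcal Z}(X,Y)U,\nu\rangle &= \tfrac12\bigl((\nabla^{M_t}_Y\dot g_t)(X,U)-(\nabla^{M_t}_X\dot g_t)(Y,U)\bigr),\\ \langle R^{\mathcal Z}(X,\nu)\nu,Y\rangle &= -\tfrac12\bigl(\ddot g_t(X,Y)+\dot g_t(W(X),Y)\bigr),\\ \operatorname{ric}^{\mathcal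 Z}(\nu,\nu) &= \operatorname{tr}(W^2)-\tfrac12\operatorname{tr}_{g_t}(\ddot g_t),\\ \operatorname{ric}^{\mathcal Z}(X,\nu) &= d_X\operatorname{tr}(W)-\langle\operatorname{div}^{M_t}(W),X\rangle,\\ \operatorname{ric}^{\mathcal Z}(X,Y) &= \operatorname{ric}^{M_t}(X,Y)+2\langle W(X),W(Y)\rangle-\operatorname{tr}(W)\langle W(X),Y\rangle-\tfrac12\,\ddot g_t(X,Y),\\ \operatorname{Scal}^{\mathcal Z} &= \operatorname{Scal}^{M_t}+3\operatorname{tr}(W^2)-\operatorname{tr}(W)^2-\operatorname{tr}_{g_t}(\ddot g_t). \end{align*} -/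

import Mathlib

open Set
open scoped Manifold ContDiff

noncomputable section

namespace GeneralizedCylinder

/-! ### Linear algebra of a nondegenerate symmetric bilinear form -/

section Algebra

variable {F : Type*} [NormedAddCommGroup F] [NormedSpace ℝ F] [FiniteDimensional ℝ F]

/-- The vector `♯ α` with `g (♯ α) v = α v` for all `v` (for nondegenerate `g`). -/
def sharp (g : F →L[ℝ] F →L[ℝ] ℝ) (α : F →L[ℝ] ℝ) : F :=
  g.inverse α

/-- The `g`-contraction of a bilinear map `B`, i.e. `∑ i, B (b i) (♯ (b^i))` for a basis `b` with
dual basis `b^i`; this does not depend on `b`, and for a `g`-orthonormal basis `e` with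
`ε i = g (e i) (e i) = ±1` it is `∑ i, ε i • B (e i) (e i)`
(see `metricContraction_eq_sum_orthonormal`). -/
def metricContraction {G : Type*} [AddCommGroup G] (g : F →L[ℝ] F →L[ℝ] ℝ)
    (B : F → F → G) : G :=
  ∑ i, B (Module.finBasis ℝ F i)
    (sharp g (LinearMap.toContinuousLinearMap ((Module.finBasis ℝ F).coord i)))

theorem metricContraction_eq_sum_orthonormal {G : Type*} [AddCommGroup G] [Module ℝ G]
    (g : F →L[ℝ] F →L[ℝ] ℝ) (B : F →ₗ[ℝ] F →ₗ[ℝ] G) {ι : Type*} [Fintype ι]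
    (e : Module.Basis ι ℝ F) (h0 : ∀ i j, i ≠ j → g (e i) (e j) = 0)
    (h1 : ∀ i, g (e i) (e i) = 1 ∨ g (e i) (e i) = -1) :
    metricContraction g (fun u v => B u v) = ∑ i, g (e i) (e i) • B (e i) (e i) := by
  classical
  have hsq : ∀ i, g (e i) (e i) * g (e i) (e i) = 1 := fun i => by
    rcases h1 i with h | h <;> rw [h] <;> norm_num
  have key : ∀ α : F →L[ℝ] ℝ, g (∑ j, (g (e j) (e j) * α (e j)) • e j) = α := by
    intro α
    apply ContinuousLinearMap.coe_injective
    apply e.ext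
    intro k
    simp only [map_sum, map_smul, ContinuousLinearMap.coe_coe, sum_apply,
      smul_apply, smul_eq_mul]
    rw [Finset.sum_eq_single k]
    · linear_combination α (e k) * hsq k
    · intro j _ hj
      rw [h0 j k hj, mul_zero]
    · simp
  have hsurj : Function.Surjective g := fun α => ⟨_, key α⟩
  have hfr : Module.finrank ℝ F = Module.finrank ℝ (F →L[ℝ] ℝ) := by
    rw [← Subspace.dual_finrank_eq (K := ℝ) (V := F)]
    exact (LinearMap.toContinuousLinearMap (𝕜 := ℝ) (E := F) (F' := ℝ)).finrank_eq
  have hinj : Function.Injective g :=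
    (LinearMap.injective_iff_surjective_of_finrank_eq_finrank (f := (g : F →ₗ[ℝ] (F →L[ℝ] ℝ)))
      hfr).2 hsurj
  let L : F ≃L[ℝ] (F →L[ℝ] ℝ) :=
    (LinearEquiv.ofBijective (g : F →ₗ[ℝ] (F →L[ℝ] ℝ)) ⟨hinj, hsurj⟩).toContinuousLinearEquiv
  have hL : g = (L : F →L[ℝ] (F →L[ℝ] ℝ)) := by
    ext u v
    rfl
  have hsharp : ∀ α : F →L[ℝ] ℝ, sharp g α = ∑ j, (g (e j) (e j) * α (e j)) • e j := by
    intro α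
    have h2 : sharp g α = L.symm α := by
      unfold sharp
      conv_lhs => rw [hL]
      rw [ContinuousLinearMap.inverse_equiv]
      rfl
    rw [h2, L.symm_apply_eq]
    exact (key α).symm
  unfold metricContraction
  simp only [hsharp, map_sum, map_smul, LinearMap.coe_toContinuousLinearMap']
  rw [Finset.sum_comm]
  refine Finset.sum_congr rfl fun j _ => ?_
  simp only [mul_smul, ← Finset.smul_sum]
  congr 1
  have h3 : e j = ∑ i, (Module.finBasis ℝ F).coord i (e j) • Module.finBasis ℝ F i := by
    simp [Module.Basis.sum_repr]
  have h4 : B (e j) (e j) =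
      B (∑ i, (Module.finBasis ℝ F).coord i (e j) • Module.finBasis ℝ F i) (e j) := by
    rw [← h3]
  rw [h4]
  simp only [map_sum, map_smul, LinearMap.sum_apply, LinearMap.smul_apply]

end Algebra

/-! ### Semi-Riemannian geometry in a chart

`G` is a field of bilinear forms on a subset `S` of a vector space `F`. All derivatives are taken
within `S`, so that boundary points are allowed. -/

section Chart

variable {F : Type*} [NormedAddCommGroup F] [NormedSpace ℝ F]

/-- The Christoffel map `Γ(u, v) = ∇_u v` of the Levi-Civita connection, on constant (coordinate)
vector fields `u`, `v`. It is given by the Koszul formula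
`G(Γ(u, v), w) = 1/2 (∂_u G(v, w) + ∂_v G(u, w) - ∂_w G(u, v))`, see `christoffel_koszul`. -/
def christoffel (G : F → F →L[ℝ] F →L[ℝ] ℝ) (S : Set F) (y : F) : F →L[ℝ] F →L[ℝ] F :=
  let D : F →L[ℝ] F →L[ℝ] F →L[ℝ] ℝ := fderivWithin ℝ G S y
  let transpose : (F →L[ℝ] F →L[ℝ] ℝ) →L[ℝ] (F →L[ℝ] F →L[ℝ] ℝ) :=
    (ContinuousLinearMap.flipₗᵢ ℝ F F ℝ).toContinuousLinearEquiv
  let raise : (F →L[ℝ] F →L[ℝ] ℝ) →L[ℝ] (F →L[ℝ] F) :=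
    ContinuousLinearMap.compL ℝ F (F →L[ℝ] ℝ) F (G y).inverse
  let A : F →L[ℝ] F →L[ℝ] F := raise.comp D
  let B : F →L[ℝ] F →L[ℝ] F := raise.comp (transpose.comp D.flip)
  (1 / 2 : ℝ) • (A + A.flip - B)

theorem christoffel_koszul (G : F → F →L[ℝ] F →L[ℝ] ℝ) (S : Set F) (y u v w : F)
    (hG : (G y).IsInvertible) :
    G y (christoffel G S y u v) w =
      1 / 2 * (fderivWithin ℝ G S y u v w + fderivWithin ℝ G S y v u w
        - fderivWithin ℝ G S y w u v) := by
  have h : ∀ α : F →L[ℝ] ℝ, G y ((G y).inverse α) = α := fun α => by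
    have := hG.self_comp_inverse
    exact congrArg (fun f : (F →L[ℝ] ℝ) →L[ℝ] (F →L[ℝ] ℝ) => f α) this
  simp [christoffel, h]

/-- `∇ Y` at `y`, as the linear map `u ↦ ∇_u Y = ∂_u Y + Γ(u, Y)`. -/
def chartCovDeriv (G : F → F →L[ℝ] F →L[ℝ] ℝ) (S : Set F) (Y : F → F) (y : F) : F →L[ℝ] F :=
  fderivWithin ℝ Y S y + (christoffel G S y).flip (Y y)

/-- The curvature tensor
`R(u, v) w = (∂_u Γ)(v, w) - (∂_v Γ)(u, w) + Γ(u, Γ(v, w)) - Γ(v, Γ(u, w))`, that is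
`∇_u ∇_v w - ∇_v ∇_u w` for constant (coordinate) vector fields `u`, `v`, `w`
(see `chartCurvature_eq`). -/
def chartCurvature (G : F → F →L[ℝ] F →L[ℝ] ℝ) (S : Set F) (y : F) :
    F →L[ℝ] F →L[ℝ] F →L[ℝ] F :=
  let Γ : F →L[ℝ] F →L[ℝ] F := christoffel G S y
  let D : F →L[ℝ] F →L[ℝ] F →L[ℝ] F := fderivWithin ℝ (christoffel G S) S y
  let Q : F →L[ℝ] F →L[ℝ] F →L[ℝ] F :=
    ((ContinuousLinearMap.compL ℝ F (F →L[ℝ] F) (F →L[ℝ] F)).flip Γ).comp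
      ((ContinuousLinearMap.compL ℝ F F F).comp Γ)
  D - D.flip + Q - Q.flip

theorem chartCurvature_apply (G : F → F →L[ℝ] F →L[ℝ] ℝ) (S : Set F) (y u v w : F) :
    chartCurvature G S y u v w =
      fderivWithin ℝ (christoffel G S) S y u v w - fderivWithin ℝ (christoffel G S) S y v u w
      + christoffel G S y u (christoffel G S y v w)
      - christoffel G S y v (christoffel G S y u w) := by
  simp [chartCurvature]

theorem chartCurvature_eq (G : F → F →L[ℝ] F →L[ℝ] ℝ) (S : Set F) (y u v w : F)
    (hS : UniqueDiffWithinAt ℝ S y) (hΓ : DifferentiableWithinAt ℝ (christoffel G S) S y) :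
    chartCurvature G S y u v w =
      chartCovDeriv G S (fun z => chartCovDeriv G S (fun _ => w) z v) y u
      - chartCovDeriv G S (fun z => chartCovDeriv G S (fun _ => w) z u) y v := by
  have h : ∀ a : F, (fun z => chartCovDeriv G S (fun _ => w) z a)
      = fun z => christoffel G S z a w := by
    intro a
    ext z
    simp [chartCovDeriv]
  have hd : ∀ a b : F, fderivWithin ℝ (fun z => christoffel G S z a w) S y b
      = fderivWithin ℝ (christoffel G S) S y b a w := by
    intro a b
    have h1 := ((hΓ.hasFDerivWithinAt.clm_apply (hasFDerivWithinAt_const a y S)).clm_apply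
      (hasFDerivWithinAt_const w y S)).fderivWithin hS
    rw [h1]
    simp
  rw [chartCurvature_apply, h, h]
  simp only [chartCovDeriv, add_apply, ContinuousLinearMap.flip_apply, hd]
  abel

/-- `∇ h` for a field of bilinear forms `h`:
`(∇_u h)(v, w) = ∂_u h(v, w) - h(Γ(u, v), w) - h(v, Γ(u, w))`. -/
def chartCovDerivBilin (G : F → F →L[ℝ] F →L[ℝ] ℝ) (S : Set F) (h : F → F →L[ℝ] F →L[ℝ] ℝ)
    (y u v w : F) : ℝ :=
  fderivWithin ℝ h S y u v w - h y (christoffel G S y u v) w - h y v (christoffel G S y u w)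

/-- `∇ A` for a field of endomorphisms `A`: `(∇_u A)(v) = (∂_u A)(v) + Γ(u, A v) - A Γ(u, v)`. -/
def chartCovDerivEnd (G : F → F →L[ℝ] F →L[ℝ] ℝ) (S : Set F) (A : F → F →L[ℝ] F)
    (y u v : F) : F :=
  fderivWithin ℝ A S y u v + christoffel G S y u (A y v) - A y (christoffel G S y u v)

end Chart

/-! ### Semi-Riemannian geometry on a manifold

Everything at a point `p` is computed in the chart `extChartAt I p`. In Mathlib the tangent space
`TangentSpace I p` is the model space `F`, identified through the differential of this very chart
(`mfderiv_extChartAt_self`), so the results computed in the chart are tensors on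
`TangentSpace I p`. The metric is given on a subset `S` of the manifold. -/

section Manifold

variable {F : Type*} [NormedAddCommGroup F] [NormedSpace ℝ F]
  {H : Type*} [TopologicalSpace H] (I : ModelWithCorners ℝ F H)
  {N : Type*} [TopologicalSpace N] [ChartedSpace H N]

/-- The part of the model space corresponding to `S` in the chart at `p`. -/
def chartSet (S : Set N) (p : N) : Set F :=
  (extChartAt I p).symm ⁻¹' S ∩ range I

/-- The differential at `y` of the inverse of the chart at `p`. -/
def chartFrame (p : N) (y : F) : F →L[ℝ] TangentSpace I ((extChartAt I p).symm y) :=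
  mfderivWithin 𝓘(ℝ, F) I (extChartAt I p).symm (range I) y

/-- A vector field read in the chart at `p`. -/
def chartField (Y : Π q : N, TangentSpace I q) (p : N) (y : F) : F :=
  (chartFrame I p y).inverse (Y ((extChartAt I p).symm y))

/-- A field of bilinear forms read in the chart at `p` (pull-back by the inverse chart). -/
def chartBilin (h : Π q : N, TangentSpace I q →L[ℝ] TangentSpace I q →L[ℝ] ℝ) (p : N) (y : F) :
    F →L[ℝ] F →L[ℝ] ℝ :=
  let hy : F →L[ℝ] F →L[ℝ] ℝ := h ((extChartAt I p).symm y)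
  let D : F →L[ℝ] F := chartFrame I p y
  hy.bilinearComp D D

/-- A field of endomorphisms read in the chart at `p`. -/
def chartEnd (A : Π q : N, TangentSpace I q →L[ℝ] TangentSpace I q) (p : N) (y : F) :
    F →L[ℝ] F :=
  (chartFrame I p y).inverse ∘L A ((extChartAt I p).symm y) ∘L chartFrame I p y

variable (G : Π q : N, TangentSpace I q →L[ℝ] TangentSpace I q →L[ℝ] ℝ) (S : Set N)

/-- The Levi-Civita covariant derivative of the vector field `Y` at `p`: `u ↦ ∇_u Y`. -/
def covDeriv (Y : Π q : N, TangentSpace I q) (p : N) : TangentSpace I p →L[ℝ] TangentSpace I p :=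
  chartCovDeriv (F := F) (chartBilin I G p) (chartSet I S p) (chartField I Y p) (extChartAt I p p)

/-- The curvature tensor at `p`: `curvature I G S p u v w = R(u, v) w`, with the sign convention
`R(X, Y) Z = ∇_X ∇_Y Z - ∇_Y ∇_X Z - ∇_[X, Y] Z`. -/
def curvature (p : N) :
    TangentSpace I p →L[ℝ] TangentSpace I p →L[ℝ] TangentSpace I p →L[ℝ] TangentSpace I p :=
  chartCurvature (F := F) (chartBilin I G p) (chartSet I S p) (extChartAt I p p)

/-- `covDerivBilin I G S h p u v w = (∇_u h)(v, w)`. -/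
def covDerivBilin (h : Π q : N, TangentSpace I q →L[ℝ] TangentSpace I q →L[ℝ] ℝ) (p : N)
    (u v w : TangentSpace I p) : ℝ :=
  chartCovDerivBilin (F := F) (chartBilin I G p) (chartSet I S p) (chartBilin I h p) (extChartAt I p p)
    u v w

/-- `covDerivEnd I G S A p u v = (∇_u A)(v)`. -/
def covDerivEnd (A : Π q : N, TangentSpace I q →L[ℝ] TangentSpace I q) (p : N)
    (u v : TangentSpace I p) : TangentSpace I p :=
  chartCovDerivEnd (F := F) (chartBilin I G p) (chartSet I S p) (chartEnd I A p) (extChartAt I p p) u v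

/-- The Ricci curvature `ric(u, v)`, the trace of the endomorphism `w ↦ R(w, u) v`. -/
def ricci (p : N) (u v : TangentSpace I p) : ℝ :=
  let R : F →L[ℝ] F →L[ℝ] F →L[ℝ] F := curvature I G S p
  let Ruv : F →L[ℝ] F := (R.flip u).flip v
  LinearMap.trace ℝ F (Ruv : F →ₗ[ℝ] F)

variable [FiniteDimensional ℝ F]

/-- The `g`-trace `tr_g h = ∑ i, ε i * h (e i) (e i)` of a bilinear form at `p`. -/
def metricTrace (p : N) (h : TangentSpace I p → TangentSpace I p → ℝ) : ℝ :=
  metricContraction (F := F) (G p) h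

/-- The scalar curvature, the metric trace of the Ricci curvature. -/
def scalarCurvature (p : N) : ℝ :=
  metricTrace I G p (ricci I G S p)

/-- The divergence `div A = ∑ i, ε i • (∇_{e i} A)(e i)` of an endomorphism field. -/
def divergence (A : Π q : N, TangentSpace I q →L[ℝ] TangentSpace I q) (p : N) : TangentSpace I p :=
  metricContraction (F := F) (G := F) (G p) (covDerivEnd I G S A p)

end Manifold

/-! ### Generalized cylinders -/

section Cylinder

variable {E : Type*} [NormedAddCommGroup E] [NormedSpace ℝ E]
  {M : Type*} [TopologicalSpace M] [ChartedSpace E M]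

/-- `g t`, `t ∈ J`, is a smooth 1-parameter family of semi-Riemannian metrics on `M`. -/
structure IsSmoothMetricFamily [IsManifold 𝓘(ℝ, E) ∞ M] (J : Set ℝ)
    (g : ℝ → Π p : M, TangentSpace 𝓘(ℝ, E) p →L[ℝ] TangentSpace 𝓘(ℝ, E) p →L[ℝ] ℝ) : Prop where
  symm : ∀ t ∈ J, ∀ p u v, g t p u v = g t p v u
  nondegenerate : ∀ t ∈ J, ∀ p u, (∀ v, g t p u v = 0) → u = 0
  smooth : ContMDiffOn (𝓘(ℝ, ℝ).prod 𝓘(ℝ, E)) (𝓘(ℝ, E).prod 𝓘(ℝ, E →L[ℝ] E →L[ℝ] ℝ)) ∞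
    (fun x : ℝ × M => Bundle.TotalSpace.mk' (E →L[ℝ] E →L[ℝ] ℝ)
      (E := fun p : M => TangentSpace 𝓘(ℝ, E) p →L[ℝ] TangentSpace 𝓘(ℝ, E) p →L[ℝ] ℝ)
      x.2 (g x.1 x.2)) (J ×ˢ univ)

variable (J : Set ℝ)
  (g : ℝ → Π p : M, TangentSpace 𝓘(ℝ, E) p →L[ℝ] TangentSpace 𝓘(ℝ, E) p →L[ℝ] ℝ)

/-- The first `t`-derivative of `g_t` on `J` (one-sided at end points), as a field of bilinear
forms on `M`. -/
def gDot (t : ℝ) (p : M) : TangentSpace 𝓘(ℝ, E) p →L[ℝ] TangentSpace 𝓘(ℝ, E) p →L[ℝ] ℝ :=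
  derivWithin (F := E →L[ℝ] E →L[ℝ] ℝ) (fun s => g s p) J t

/-- The second `t`-derivative of `g_t` on `J`. -/
def gDDot (t : ℝ) (p : M) : TangentSpace 𝓘(ℝ, E) p →L[ℝ] TangentSpace 𝓘(ℝ, E) p →L[ℝ] ℝ :=
  derivWithin (F := E →L[ℝ] E →L[ℝ] ℝ) (fun s => gDot J g s p) J t

/-- The tangent space of `ℝ × M` at `(t, p)` is `ℝ × T_p M`; `tangential v = (0, v)`. -/
def tangential (x : ℝ × M) :
    TangentSpace 𝓘(ℝ, E) x.2 →L[ℝ] TangentSpace (𝓘(ℝ, ℝ).prod 𝓘(ℝ, E)) x :=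
  ContinuousLinearMap.inr ℝ ℝ E

/-- The `T_p M`-component of a tangent vector of `ℝ × M` at `(t, p)`. -/
def tangentialPart (x : ℝ × M) :
    TangentSpace (𝓘(ℝ, ℝ).prod 𝓘(ℝ, E)) x →L[ℝ] TangentSpace 𝓘(ℝ, E) x.2 :=
  ContinuousLinearMap.snd ℝ ℝ E

/-- The vector field `ν = ∂/∂t = (1, 0)` on `ℝ × M`. -/
def nu (x : ℝ × M) : TangentSpace (𝓘(ℝ, ℝ).prod 𝓘(ℝ, E)) x :=
  ((1, 0) : ℝ × E)

/-- The metric `dt² + g_t` on `J × M ⊆ ℝ × M`: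
`⟨(a, u), (b, v)⟩ = a b + g_t(u, v)` at `(t, p)`. -/
def cylinderMetric (x : ℝ × M) :
    TangentSpace (𝓘(ℝ, ℝ).prod 𝓘(ℝ, E)) x →L[ℝ]
      TangentSpace (𝓘(ℝ, ℝ).prod 𝓘(ℝ, E)) x →L[ℝ] ℝ :=
  let gx : E →L[ℝ] E →L[ℝ] ℝ := g x.1 x.2
  let fst : ℝ × E →L[ℝ] ℝ := ContinuousLinearMap.fst ℝ ℝ E
  let snd : ℝ × E →L[ℝ] E := ContinuousLinearMap.snd ℝ ℝ E
  (ContinuousLinearMap.mul ℝ ℝ).bilinearComp fst fst + gx.bilinearComp snd snd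

/-- The Weingarten map `W(X) = - ∇_X ν` of `{t} × M` in the generalized cylinder, as an
endomorphism field on `M`. (It takes the `T_p M`-component of `- ∇_X ν`.) -/
def weingarten (t : ℝ) (p : M) : TangentSpace 𝓘(ℝ, E) p →L[ℝ] TangentSpace 𝓘(ℝ, E) p :=
  -(tangentialPart (E := E) (t, p) ∘L
    covDeriv (𝓘(ℝ, ℝ).prod 𝓘(ℝ, E)) (cylinderMetric g) (J ×ˢ univ) nu (t, p) ∘L
    tangential (E := E) (t, p))

/-- The trace of an endomorphism of `T_p M`. -/
def endTrace {p : M} (A : TangentSpace 𝓘(ℝ, E) p →L[ℝ] TangentSpace 𝓘(ℝ, E) p) : ℝ :=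
  LinearMap.trace ℝ (TangentSpace 𝓘(ℝ, E) p)
    (A : TangentSpace 𝓘(ℝ, E) p →ₗ[ℝ] TangentSpace 𝓘(ℝ, E) p)

end Cylinder

end GeneralizedCylinder

end

/-!
In a chart `φ` of `M` the metric of the cylinder is `dt² + h_t`, where `h_t` is `g_t` read in `φ`.
The Koszul formula determines its Christoffel map (`IsChartFamily.cylinderChristoffel_apply`):
`Γ((a, u), (b, v)) = (-1/2 ḣ(u, v), Γ_t(u, v) - a W v - b W u)`,
where `Γ_t` belongs to `h_t` and the endomorphism `W` is given by `h_t(W u, v) = -1/2 ḣ(u, v)`.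
The normal component is Gauss' formula for the second fundamental form, the tangential one says
that the slices inherit their own connection and that `∇_u ∂_t = -W u`.

Every formula for the curvature tensor follows by inserting this into
`R(u, v) w = ∂_u Γ(v, w) - ∂_v Γ(u, w) + Γ(u, Γ(v, w)) - Γ(v, Γ(u, w))`. `Γ_t` is only
differentiated along the slice, `ḣ` and `W` in all directions. This gives the Gauss equation
(`IsChartFamily.cylinderCurvature_tangential_snd`), the Codazzi equation
(`IsChartFamily.cylinderCurvature_tangential_fst`) and the Riccati equation
`R(u, ν) ν = Ẇ u - W² u` (`IsChartFamily.cylinderCurvature_normal_normal`), in which `Ẇ` is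
eliminated by differentiating `h_t(W u, v) = -1/2 ḣ(u, v)`.

The Ricci formulas are traces of these, taken by splitting an endomorphism of `ℝ × E` into its
two diagonal blocks (`trace_prod_real`). For `ric(X, ν)` one also needs that `∇_u W` is
self-adjoint and the connection symmetric, so that `⟨div W, X⟩ = tr (u ↦ (∇_u W) X)` and the two
terms containing `Γ_t` cancel. For the scalar curvature the contraction of a bilinear form with
respect to a metric is written as the trace of the endomorphism representing it
(`metricContraction_eq_trace`).

On the manifold the chart at a point changes with the point. The Weingarten map at `q`, defined
through the chart at `q`, agrees with the one read in the chart at `p` because both are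
determined by `⟨W X, Y⟩ = -1/2 ġ(X, Y)`, and `ġ` transforms as a tensor
(`IsSmoothMetricFamily.chartEnd_weingarten`).
-/

noncomputable section

-- Instances on spaces such as `F →L[ℝ] F →L[ℝ] F →L[ℝ] ℝ` need a deeper nested search.
set_option maxSynthPendingDepth 3

namespace GeneralizedCylinder

/-! ### Differentiability along the slices of a product, and of the Christoffel map -/

section ChartCalculus

variable {E : Type*} [NormedAddCommGroup E] [NormedSpace ℝ E]
  {F : Type*} [NormedAddCommGroup F] [NormedSpace ℝ F]

/-- The second factor of `J ×ˢ univ` is the whole space, so the restriction to `{x.1} × E` has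
an unrestricted derivative. -/
theorem hasFDerivAt_slice_snd {J : Set ℝ} {f : ℝ × E → F} {f' : ℝ × E →L[ℝ] F} {x : ℝ × E}
    (hx : x.1 ∈ J) (hf : HasFDerivWithinAt f f' (J ×ˢ univ) x) :
    HasFDerivAt (fun y => f (x.1, y)) (f'.comp (ContinuousLinearMap.inr ℝ ℝ E)) x.2 := by
  rw [← hasFDerivWithinAt_univ]
  exact HasFDerivWithinAt.comp (t := J ×ˢ univ) x.2 hf
    (hasFDerivAt_prodMk_right x.1 x.2).hasFDerivWithinAt (fun y _ => ⟨hx, mem_univ y⟩)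

theorem hasDerivWithinAt_slice_fst {J : Set ℝ} {f : ℝ × E → F} {f' : ℝ × E →L[ℝ] F} {x : ℝ × E}
    (hf : HasFDerivWithinAt f f' (J ×ˢ univ) x) :
    HasDerivWithinAt (fun s => f (s, x.2)) (f' (1, 0)) J x.1 := by
  have := HasFDerivWithinAt.comp (t := J ×ˢ univ) x.1 hf
    (hasFDerivAt_prodMk_left (𝕜 := ℝ) x.1 x.2).hasFDerivWithinAt
    (s := J) (fun y hy => ⟨hy, mem_univ _⟩)
  simpa [Function.comp_def] using this.hasDerivWithinAt

variable [FiniteDimensional ℝ F]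

theorem differentiableWithinAt_christoffel {G : F → F →L[ℝ] F →L[ℝ] ℝ} {S : Set F} {y : F}
    (hG : DifferentiableWithinAt ℝ G S y) (hinv : (G y).IsInvertible)
    (hD : DifferentiableWithinAt ℝ (fderivWithin ℝ G S) S y) :
    DifferentiableWithinAt ℝ (christoffel G S) S y := by
  have := FiniteDimensional.complete ℝ F
  have hI : DifferentiableWithinAt ℝ (fun z => (G z).inverse) S y :=
    ((hinv.contDiffAt_map_inverse (n := 1)).differentiableAt one_ne_zero).comp_differentiableWithinAt
      y hG
  have hr : DifferentiableWithinAt ℝ (fun z =>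
      ContinuousLinearMap.compL ℝ F (F →L[ℝ] ℝ) F (G z).inverse) S y :=
    (ContinuousLinearMap.differentiableAt (ContinuousLinearMap.compL ℝ F (F →L[ℝ] ℝ) F)
      ).comp_differentiableWithinAt y hI
  have hA := hr.clm_comp hD
  have hDf : DifferentiableWithinAt ℝ (fun z => (fderivWithin ℝ G S z).flip) S y :=
    ((ContinuousLinearMap.flipₗᵢ ℝ F F (F →L[ℝ] ℝ)).toContinuousLinearEquiv.differentiableAt
      ).comp_differentiableWithinAt y hD
  have hB := hr.clm_comp ((differentiableWithinAt_const
    (((ContinuousLinearMap.flipₗᵢ ℝ F F ℝ).toContinuousLinearEquiv :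
      (F →L[ℝ] F →L[ℝ] ℝ) →L[ℝ] (F →L[ℝ] F →L[ℝ] ℝ)))).clm_comp hDf)
  have hAf := ((ContinuousLinearMap.flipₗᵢ ℝ F F F).toContinuousLinearEquiv.differentiableAt
      ).comp_differentiableWithinAt y hA
  exact ((hA.add hAf).sub hB).const_smul (1 / 2 : ℝ)

end ChartCalculus

/-! ### Families of metrics in a chart and the metric `dt² + h_t` -/

section ChartFamily

variable {E : Type*} [NormedAddCommGroup E] [NormedSpace ℝ E]

/-- The bilinear form `(a, u), (b, v) ↦ a b + k(u, v)` on `ℝ × E`. -/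
def cylinderForm (k : E →L[ℝ] E →L[ℝ] ℝ) : ℝ × E →L[ℝ] ℝ × E →L[ℝ] ℝ :=
  (ContinuousLinearMap.mul ℝ ℝ).bilinearComp (ContinuousLinearMap.fst ℝ ℝ E)
      (ContinuousLinearMap.fst ℝ ℝ E)
    + k.bilinearComp (ContinuousLinearMap.snd ℝ ℝ E) (ContinuousLinearMap.snd ℝ ℝ E)

@[simp] theorem cylinderForm_apply (k : E →L[ℝ] E →L[ℝ] ℝ) (u v : ℝ × E) :
    cylinderForm k u v = u.1 * v.1 + k u.2 v.2 := by
  simp [cylinderForm]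

theorem isInvertible_of_nondegenerate [FiniteDimensional ℝ E] {k : E →L[ℝ] E →L[ℝ] ℝ}
    (hk : ∀ u, (∀ v, k u v = 0) → u = 0) : k.IsInvertible := by
  have hinj : Function.Injective (k : E →ₗ[ℝ] (E →L[ℝ] ℝ)) := by
    rw [← LinearMap.ker_eq_bot, LinearMap.ker_eq_bot']
    intro u hu
    exact hk u fun v => by
      have := congrArg (fun f : E →L[ℝ] ℝ => f v) hu
      simpa using this
  have hfr : Module.finrank ℝ E = Module.finrank ℝ (E →L[ℝ] ℝ) := by
    rw [← Subspace.dual_finrank_eq (K := ℝ) (V := E)]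
    exact (LinearMap.toContinuousLinearMap (𝕜 := ℝ) (E := E) (F' := ℝ)).finrank_eq
  exact ⟨(LinearEquiv.ofBijective (k : E →ₗ[ℝ] (E →L[ℝ] ℝ)) ⟨hinj,
    (LinearMap.injective_iff_surjective_of_finrank_eq_finrank hfr).1 hinj⟩).toContinuousLinearEquiv,
    by ext; rfl⟩

theorem nondegenerate_cylinderForm {k : E →L[ℝ] E →L[ℝ] ℝ}
    (hk : ∀ u, (∀ v, k u v = 0) → u = 0) (u : ℝ × E) (hu : ∀ v, cylinderForm k u v = 0) :
    u = 0 := by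
  ext
  · simpa using hu (1, 0)
  · exact hk _ fun v => by simpa using hu (0, v)

/-- A smooth 1-parameter family of semi-Riemannian metrics on an open subset `V` of `E`,
with parameter in `J`: the metric at time `s` and at the point `y` is `h (s, y)`. -/
structure IsChartFamily (J : Set ℝ) (V : Set E) (h : ℝ × E → E →L[ℝ] E →L[ℝ] ℝ) : Prop where
  uniqueDiffOn : UniqueDiffOn ℝ J
  isOpen : IsOpen V
  contDiffOn : ContDiffOn ℝ ∞ h (J ×ˢ V)
  symm : ∀ x ∈ J ×ˢ V, ∀ u v, h x u v = h x v u
  nondegenerate : ∀ x ∈ J ×ˢ V, ∀ u, (∀ v, h x u v = 0) → u = 0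

end ChartFamily

/-! ### The Levi-Civita connection of `dt² + h_t` in a chart -/

section ChartFamily

variable {E : Type*} [NormedAddCommGroup E] [NormedSpace ℝ E]

/-- The Christoffel map of `dt² + h_t` on `J × E`. -/
def cylinderChristoffel (J : Set ℝ) (h : ℝ × E → E →L[ℝ] E →L[ℝ] ℝ) (x : ℝ × E) :
    ℝ × E →L[ℝ] ℝ × E →L[ℝ] ℝ × E :=
  christoffel (fun z => cylinderForm (h z)) (J ×ˢ univ) x

/-- The derivative of `h` in the parameter, taken within `J`. -/
def chartDot (J : Set ℝ) (h : ℝ × E → E →L[ℝ] E →L[ℝ] ℝ) (x : ℝ × E) : E →L[ℝ] E →L[ℝ] ℝ :=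
  derivWithin (fun s => h (s, x.2)) J x.1

/-- The Weingarten map `u ↦ -∇_u ∂_t` of the slices of `dt² + h_t` in a chart. -/
def chartWeingarten (J : Set ℝ) (h : ℝ × E → E →L[ℝ] E →L[ℝ] ℝ) (x : ℝ × E) : E →L[ℝ] E :=
  -(ContinuousLinearMap.snd ℝ ℝ E ∘L (cylinderChristoffel J h x).flip (1, 0) ∘L
    ContinuousLinearMap.inr ℝ ℝ E)

/-- The Christoffel map of the metric `h_t` on the slice `{t} × E`. -/
def sliceChristoffel (h : ℝ × E → E →L[ℝ] E →L[ℝ] ℝ) (x : ℝ × E) : E →L[ℝ] E →L[ℝ] E :=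
  christoffel (fun y => h (x.1, y)) univ x.2

theorem chartWeingarten_apply (J : Set ℝ) (h : ℝ × E → E →L[ℝ] E →L[ℝ] ℝ) (x : ℝ × E) (u : E) :
    chartWeingarten J h x u = -(cylinderChristoffel J h x (0, u) (1, 0)).2 := by
  simp [chartWeingarten]

namespace IsChartFamily

variable {F : Type*} [NormedAddCommGroup F] [NormedSpace ℝ F]
  {J : Set ℝ} {V : Set E} {h : ℝ × E → E →L[ℝ] E →L[ℝ] ℝ} {x : ℝ × E}

/-- Derivatives within `J ×ˢ univ` at a point of `J ×ˢ V` only see `J ×ˢ V`. -/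
theorem mem_nhdsWithin (H : IsChartFamily J V h) (hx : x ∈ J ×ˢ V) :
    J ×ˢ V ∈ nhdsWithin x (J ×ˢ univ) := by
  have h1 : (univ : Set ℝ) ×ˢ V ∈ nhds x :=
    (isOpen_univ.prod H.isOpen).mem_nhds ⟨mem_univ _, hx.2⟩
  have h2 : J ×ˢ V = (univ ×ˢ V) ∩ (J ×ˢ univ) := by
    ext z; simp [and_comm]
  rw [h2]
  exact Filter.inter_mem (mem_nhdsWithin_of_mem_nhds h1) self_mem_nhdsWithin

theorem uniqueDiffWithinAt (H : IsChartFamily J V h) (hx : x ∈ J ×ˢ V) :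
    UniqueDiffWithinAt ℝ (J ×ˢ univ) x :=
  (H.uniqueDiffOn.prod uniqueDiffOn_univ) x ⟨hx.1, mem_univ _⟩

theorem differentiableWithinAt_of_contDiffOn (H : IsChartFamily J V h) (hx : x ∈ J ×ˢ V)
    {f : ℝ × E → F} (hf : ContDiffOn ℝ ∞ f (J ×ˢ V)) :
    DifferentiableWithinAt ℝ f (J ×ˢ univ) x :=
  ((hf.differentiableOn (by simp)) x hx).mono_of_mem_nhdsWithin (H.mem_nhdsWithin hx)

theorem contDiffOn_fderivWithin (H : IsChartFamily J V h)
    {f : ℝ × E → F} (hf : ContDiffOn ℝ ∞ f (J ×ˢ V)) :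
    ContDiffOn ℝ ∞ (fderivWithin ℝ f (J ×ˢ univ)) (J ×ˢ V) := by
  refine (hf.fderivWithin (m := ∞) (H.uniqueDiffOn.prod H.isOpen.uniqueDiffOn) (by simp)).congr ?_
  intro z hz
  refine fderivWithin_congr_set ?_
  have h1 : (univ : Set ℝ) ×ˢ V ∈ nhds z :=
    (isOpen_univ.prod H.isOpen).mem_nhds ⟨mem_univ _, hz.2⟩
  filter_upwards [h1] with w hw
  exact propext ⟨fun k => ⟨k.1, hw.2⟩, fun k => ⟨k.1, mem_univ _⟩⟩

theorem eq_of_forall_apply_eq (H : IsChartFamily J V h) (hx : x ∈ J ×ˢ V) {u v : E}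
    (huv : ∀ w, h x u w = h x v w) : u = v :=
  sub_eq_zero.1 <| H.nondegenerate x hx _ fun w => by simp [huv w]

theorem fderivWithin_slice (hx : x.1 ∈ J) {f : ℝ × E → F}
    (hf : DifferentiableWithinAt ℝ f (J ×ˢ univ) x) (u : E) :
    fderivWithin ℝ (fun y => f (x.1, y)) univ x.2 u = fderivWithin ℝ f (J ×ˢ univ) x (0, u) := by
  rw [fderivWithin_univ, (hasFDerivAt_slice_snd hx hf.hasFDerivWithinAt).fderiv]
  simp

theorem derivWithin_slice (H : IsChartFamily J V h) (hx : x ∈ J ×ˢ V) {f : ℝ × E → F}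
    (hf : DifferentiableWithinAt ℝ f (J ×ˢ univ) x) :
    derivWithin (fun s => f (s, x.2)) J x.1 = fderivWithin ℝ f (J ×ˢ univ) x (1, 0) :=
  (hasDerivWithinAt_slice_fst hf.hasFDerivWithinAt).derivWithin (H.uniqueDiffOn _ hx.1)

theorem chartDot_eq (H : IsChartFamily J V h) (hx : x ∈ J ×ˢ V) :
    chartDot J h x = fderivWithin ℝ h (J ×ˢ univ) x (1, 0) :=
  (hasDerivWithinAt_slice_fst (H.differentiableWithinAt_of_contDiffOn hx
    H.contDiffOn).hasFDerivWithinAt).derivWithin (H.uniqueDiffOn _ hx.1)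

theorem contDiffOn_chartDot (H : IsChartFamily J V h) : ContDiffOn ℝ ∞ (chartDot J h) (J ×ˢ V) :=
  ((H.contDiffOn_fderivWithin H.contDiffOn).clm_apply contDiffOn_const).congr
    fun _ hx => H.chartDot_eq hx

theorem symm_fderivWithin (H : IsChartFamily J V h) (hx : x ∈ J ×ˢ V) (U : ℝ × E) (u v : E) :
    fderivWithin ℝ h (J ×ˢ univ) x U u v = fderivWithin ℝ h (J ×ˢ univ) x U v u := by
  have hd := (H.differentiableWithinAt_of_contDiffOn hx H.contDiffOn).hasFDerivWithinAt
  have key : ∀ u v : E, fderivWithin ℝ h (J ×ˢ univ) x U u v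
      = fderivWithin ℝ (fun z => h z u v) (J ×ˢ univ) x U := fun u v => by
    rw [((hd.clm_apply (hasFDerivWithinAt_const u x _)).clm_apply
      (hasFDerivWithinAt_const v x _)).fderivWithin (H.uniqueDiffWithinAt hx)]
    simp
  rw [key, key]
  refine congrArg (fun L : ℝ × E →L[ℝ] ℝ => L U) (Filter.EventuallyEq.fderivWithin_eq ?_ ?_)
  · filter_upwards [H.mem_nhdsWithin hx] with z hz using H.symm z hz u v
  · exact H.symm x hx u v

theorem chartDot_symm (H : IsChartFamily J V h) (hx : x ∈ J ×ˢ V) (u v : E) :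
    chartDot J h x u v = chartDot J h x v u := by
  rw [H.chartDot_eq hx, H.symm_fderivWithin hx]

variable [FiniteDimensional ℝ E]

theorem contDiffOn_cylinderForm (H : IsChartFamily J V h) :
    ContDiffOn ℝ ∞ (fun z => cylinderForm (h z)) (J ×ˢ V) := by
  refine contDiffOn_clm_apply.2 fun u => contDiffOn_clm_apply.2 fun v => ?_
  simp only [cylinderForm_apply]
  exact contDiffOn_const.add ((H.contDiffOn.clm_apply contDiffOn_const).clm_apply contDiffOn_const)

theorem isInvertible (H : IsChartFamily J V h) (hx : x ∈ J ×ˢ V) : (h x).IsInvertible :=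
  isInvertible_of_nondegenerate (H.nondegenerate x hx)

theorem isInvertible_cylinderForm (H : IsChartFamily J V h) (hx : x ∈ J ×ˢ V) :
    (cylinderForm (h x)).IsInvertible :=
  isInvertible_of_nondegenerate (nondegenerate_cylinderForm (H.nondegenerate x hx))

theorem differentiableWithinAt_cylinderChristoffel (H : IsChartFamily J V h) (hx : x ∈ J ×ˢ V) :
    DifferentiableWithinAt ℝ (cylinderChristoffel J h) (J ×ˢ univ) x :=
  differentiableWithinAt_christoffel
    (H.differentiableWithinAt_of_contDiffOn hx H.contDiffOn_cylinderForm)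
    (H.isInvertible_cylinderForm hx)
    (H.differentiableWithinAt_of_contDiffOn hx
      (H.contDiffOn_fderivWithin H.contDiffOn_cylinderForm))

theorem fderivWithin_cylinderForm (H : IsChartFamily J V h) (hx : x ∈ J ×ˢ V) (U A B : ℝ × E) :
    fderivWithin ℝ (fun z => cylinderForm (h z)) (J ×ˢ univ) x U A B
      = fderivWithin ℝ h (J ×ˢ univ) x U A.2 B.2 := by
  have hu := H.uniqueDiffWithinAt hx
  have hd := (H.differentiableWithinAt_of_contDiffOn hx H.contDiffOn).hasFDerivWithinAt
  have hG := (H.differentiableWithinAt_of_contDiffOn hx H.contDiffOn_cylinderForm).hasFDerivWithinAt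
  have h1 := (hG.clm_apply (hasFDerivWithinAt_const A x _)).clm_apply
      (hasFDerivWithinAt_const B x _)
  have h2 := ((hd.clm_apply (hasFDerivWithinAt_const A.2 x _)).clm_apply
      (hasFDerivWithinAt_const B.2 x _)).const_add (A.1 * B.1)
  simp only [cylinderForm_apply] at h1
  have := congrArg (fun L : ℝ × E →L[ℝ] ℝ => L U) (hu.eq h1 h2)
  simpa using this

/-- The Koszul formula for `dt² + h_t`; only `h` contributes to the derivative of the metric. -/
theorem koszul (H : IsChartFamily J V h) (hx : x ∈ J ×ˢ V) (A B C : ℝ × E) :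
    cylinderForm (h x) (cylinderChristoffel J h x A B) C =
      1 / 2 * (fderivWithin ℝ h (J ×ˢ univ) x A B.2 C.2 + fderivWithin ℝ h (J ×ˢ univ) x B A.2 C.2
        - fderivWithin ℝ h (J ×ˢ univ) x C A.2 B.2) := by
  have := christoffel_koszul (fun z => cylinderForm (h z)) (J ×ˢ univ) x A B C
    (H.isInvertible_cylinderForm hx)
  simp only [H.fderivWithin_cylinderForm hx] at this
  exact this

/-- The Koszul formula for `h_t`, with the derivatives of `h_t` on the slice written as derivatives
of `h` in the directions tangential to the slice. -/
theorem koszul_slice (H : IsChartFamily J V h) (hx : x ∈ J ×ˢ V) (u v w : E) :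
    h x (sliceChristoffel h x u v) w =
      1 / 2 * (fderivWithin ℝ h (J ×ˢ univ) x (0, u) v w + fderivWithin ℝ h (J ×ˢ univ) x (0, v) u w
        - fderivWithin ℝ h (J ×ˢ univ) x (0, w) u v) := by
  have := christoffel_koszul (fun y => h (x.1, y)) univ x.2 u v w (H.isInvertible hx)
  simp only [fderivWithin_slice hx.1 (H.differentiableWithinAt_of_contDiffOn hx H.contDiffOn)]
    at this
  exact this

/-- The second fundamental form of the slices is `-1/2 ḣ`. -/
theorem cylinderChristoffel_fst (H : IsChartFamily J V h) (hx : x ∈ J ×ˢ V) (A B : ℝ × E) :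
    (cylinderChristoffel J h x A B).1 = -(1 / 2) * chartDot J h x A.2 B.2 := by
  have := H.koszul hx A B (1, 0)
  simp [← H.chartDot_eq hx] at this
  rw [this]; ring

theorem cylinderChristoffel_symm (H : IsChartFamily J V h) (hx : x ∈ J ×ˢ V) (A B : ℝ × E) :
    cylinderChristoffel J h x A B = cylinderChristoffel J h x B A := by
  refine sub_eq_zero.1 (nondegenerate_cylinderForm (H.nondegenerate x hx) _ fun C => ?_)
  rw [map_sub, sub_apply, H.koszul hx, H.koszul hx, H.symm_fderivWithin hx C]
  ring

theorem sliceChristoffel_symm (H : IsChartFamily J V h) (hx : x ∈ J ×ˢ V) (u v : E) :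
    sliceChristoffel h x u v = sliceChristoffel h x v u := by
  refine H.eq_of_forall_apply_eq hx fun w => ?_
  rw [H.koszul_slice hx, H.koszul_slice hx, H.symm_fderivWithin hx (0, w)]
  ring

/-- The slices inherit their own Levi-Civita connection. -/
theorem cylinderChristoffel_inr_inr (H : IsChartFamily J V h) (hx : x ∈ J ×ˢ V) (u v : E) :
    (cylinderChristoffel J h x (0, u) (0, v)).2 = sliceChristoffel h x u v := by
  refine H.eq_of_forall_apply_eq hx fun w => ?_
  rw [H.koszul_slice hx]
  simpa using H.koszul hx (0, u) (0, v) (0, w)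

/-- The lines `ℝ × {y}` are geodesics. -/
theorem cylinderChristoffel_inl_inl (H : IsChartFamily J V h) (hx : x ∈ J ×ˢ V) (a b : ℝ) :
    cylinderChristoffel J h x (a, 0) (b, 0) = 0 := by
  refine nondegenerate_cylinderForm (H.nondegenerate x hx) _ fun C => ?_
  rw [H.koszul hx]
  simp

/-- This formula determines `W`, since the metric is nondegenerate. -/
theorem metric_chartWeingarten (H : IsChartFamily J V h) (hx : x ∈ J ×ˢ V) (u v : E) :
    h x (chartWeingarten J h x u) v = -(1 / 2) * chartDot J h x u v := by
  have := H.koszul hx (0, u) (1, 0) (0, v)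
  simp [← H.chartDot_eq hx] at this
  rw [chartWeingarten_apply, map_neg, neg_apply, this]
  ring

theorem chartDot_eq_metric_chartWeingarten (H : IsChartFamily J V h) (hx : x ∈ J ×ˢ V) (u v : E) :
    chartDot J h x u v = -2 * h x (chartWeingarten J h x u) v := by
  rw [H.metric_chartWeingarten hx]; ring

theorem metric_chartWeingarten_symm (H : IsChartFamily J V h) (hx : x ∈ J ×ˢ V) (u v : E) :
    h x (chartWeingarten J h x u) v = h x u (chartWeingarten J h x v) := by
  rw [H.metric_chartWeingarten hx, H.symm x hx u, H.metric_chartWeingarten hx, H.chartDot_symm hx]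

/-- The Christoffel map of the cylinder in terms of that of the slice, the Weingarten map and
the derivative of the metric. -/
theorem cylinderChristoffel_apply (H : IsChartFamily J V h) (hx : x ∈ J ×ˢ V) (a b : ℝ) (u v : E) :
    cylinderChristoffel J h x (a, u) (b, v) = (-(1 / 2) * chartDot J h x u v,
      sliceChristoffel h x u v - a • chartWeingarten J h x v - b • chartWeingarten J h x u) := by
  ext
  · simpa using H.cylinderChristoffel_fst hx (a, u) (b, v)
  · have hd : ∀ (c : ℝ) (w : E), ((c, w) : ℝ × E) = c • (1, 0) + (0, w) := fun c w => by simp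
    have h3 := H.cylinderChristoffel_inl_inl hx 1 1
    rw [hd a u, hd b v]
    simp only [map_add, map_smul, add_apply, smul_apply, h3, chartWeingarten_apply,
      H.cylinderChristoffel_symm hx (1, 0) (0, v), ← H.cylinderChristoffel_inr_inr hx,
      Prod.snd_add, Prod.smul_snd, Prod.snd_zero, smul_zero]
    module

end IsChartFamily
end ChartFamily

/-! ### The curvature tensor of `dt² + h_t` in a chart -/

section ChartCurvature

variable {E : Type*} [NormedAddCommGroup E] [NormedSpace ℝ E]

theorem fderivWithin_apply_apply {X A B C : Type*} [NormedAddCommGroup X] [NormedSpace ℝ X]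
    [NormedAddCommGroup A] [NormedSpace ℝ A] [NormedAddCommGroup B] [NormedSpace ℝ B]
    [NormedAddCommGroup C] [NormedSpace ℝ C] {f : X → A →L[ℝ] B →L[ℝ] C} {S : Set X} {x : X}
    (hS : UniqueDiffWithinAt ℝ S x) (hf : DifferentiableWithinAt ℝ f S x) (a : A) (b : B) (u : X) :
    fderivWithin ℝ f S x u a b = fderivWithin ℝ (fun z => f z a b) S x u := by
  rw [((hf.hasFDerivWithinAt.clm_apply (hasFDerivWithinAt_const a x S)).clm_apply
    (hasFDerivWithinAt_const b x S)).fderivWithin hS]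
  simp

/-- The curvature tensor of `dt² + h_t` on `J × E`. -/
def cylinderCurvature (J : Set ℝ) (h : ℝ × E → E →L[ℝ] E →L[ℝ] ℝ) (x : ℝ × E) :
    ℝ × E →L[ℝ] ℝ × E →L[ℝ] ℝ × E →L[ℝ] ℝ × E :=
  chartCurvature (fun z => cylinderForm (h z)) (J ×ˢ univ) x

/-- The curvature tensor of the metric `h_t` on the slice `{t} × E`. -/
def sliceCurvature (h : ℝ × E → E →L[ℝ] E →L[ℝ] ℝ) (x : ℝ × E) : E →L[ℝ] E →L[ℝ] E →L[ℝ] E :=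
  chartCurvature (fun y => h (x.1, y)) univ x.2

/-- The second derivative of `h` in the parameter, taken within `J`. -/
def chartDDot (J : Set ℝ) (h : ℝ × E → E →L[ℝ] E →L[ℝ] ℝ) (x : ℝ × E) : E →L[ℝ] E →L[ℝ] ℝ :=
  derivWithin (fun s => chartDot J h (s, x.2)) J x.1

namespace IsChartFamily

variable {J : Set ℝ} {V : Set E} {h : ℝ × E → E →L[ℝ] E →L[ℝ] ℝ} {x : ℝ × E}

theorem differentiableWithinAt_chartDot (H : IsChartFamily J V h) (hx : x ∈ J ×ˢ V) :
    DifferentiableWithinAt ℝ (chartDot J h) (J ×ˢ univ) x :=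
  H.differentiableWithinAt_of_contDiffOn hx H.contDiffOn_chartDot

theorem cylinderCurvature_apply (x U A B : ℝ × E) :
    cylinderCurvature J h x U A B =
      fderivWithin ℝ (cylinderChristoffel J h) (J ×ˢ univ) x U A B
      - fderivWithin ℝ (cylinderChristoffel J h) (J ×ˢ univ) x A U B
      + cylinderChristoffel J h x U (cylinderChristoffel J h x A B)
      - cylinderChristoffel J h x A (cylinderChristoffel J h x U B) :=
  chartCurvature_apply _ _ _ _ _ _

theorem sliceCurvature_apply (x : ℝ × E) (u v w : E) :
    sliceCurvature h x u v w =
      fderivWithin ℝ (christoffel (fun y => h (x.1, y)) univ) univ x.2 u v w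
      - fderivWithin ℝ (christoffel (fun y => h (x.1, y)) univ) univ x.2 v u w
      + sliceChristoffel h x u (sliceChristoffel h x v w)
      - sliceChristoffel h x v (sliceChristoffel h x u w) :=
  chartCurvature_apply _ _ _ _ _ _

theorem chartDDot_eq (H : IsChartFamily J V h) (hx : x ∈ J ×ˢ V) :
    chartDDot J h x = fderivWithin ℝ (chartDot J h) (J ×ˢ univ) x (1, 0) :=
  H.derivWithin_slice hx (H.differentiableWithinAt_chartDot hx)

variable [FiniteDimensional ℝ E]

theorem differentiableWithinAt_chartWeingarten (H : IsChartFamily J V h) (hx : x ∈ J ×ˢ V) :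
    DifferentiableWithinAt ℝ (chartWeingarten J h) (J ×ˢ univ) x := by
  have h1 := (ContinuousLinearMap.flipₗᵢ ℝ (ℝ × E) (ℝ × E)
    (ℝ × E)).toContinuousLinearEquiv.differentiableAt.comp_differentiableWithinAt x
    (H.differentiableWithinAt_cylinderChristoffel hx)
  have h2 := h1.clm_apply (differentiableWithinAt_const ((1, 0) : ℝ × E))
  exact ((differentiableWithinAt_const (ContinuousLinearMap.snd ℝ ℝ E)).clm_comp
    (h2.clm_comp (differentiableWithinAt_const (ContinuousLinearMap.inr ℝ ℝ E)))).neg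

theorem fderivWithin_christoffel_fst (H : IsChartFamily J V h) (hx : x ∈ J ×ˢ V) (U A B : ℝ × E) :
    (fderivWithin ℝ (cylinderChristoffel J h) (J ×ˢ univ) x U A B).1
      = -(1 / 2) * fderivWithin ℝ (chartDot J h) (J ×ˢ univ) x U A.2 B.2 := by
  have hu := H.uniqueDiffWithinAt hx
  have hΓ := ((H.differentiableWithinAt_cylinderChristoffel hx).hasFDerivWithinAt.clm_apply
    (hasFDerivWithinAt_const A x _)).clm_apply (hasFDerivWithinAt_const B x _)
  have hd := ((H.differentiableWithinAt_chartDot hx).hasFDerivWithinAt.clm_apply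
    (hasFDerivWithinAt_const A.2 x _)).clm_apply (hasFDerivWithinAt_const B.2 x _)
  have h1 := (hΓ.fst).congr_of_eventuallyEq (f₁ := fun z => -(1 / 2) * chartDot J h z A.2 B.2)
    (by filter_upwards [H.mem_nhdsWithin hx] with z hz
        exact (H.cylinderChristoffel_fst hz A B).symm)
    (H.cylinderChristoffel_fst hx A B).symm
  have := congrArg (fun L : ℝ × E →L[ℝ] ℝ => L U) (hu.eq h1 (hd.const_mul (-(1 / 2))))
  simpa using this

/-- Along a slice, the tangential part of the Christoffel map of the cylinder is that of the slice,
so their derivatives along the slice agree. -/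
theorem fderivWithin_christoffel_snd_inr (H : IsChartFamily J V h) (hx : x ∈ J ×ˢ V) (u v w : E) :
    (fderivWithin ℝ (cylinderChristoffel J h) (J ×ˢ univ) x (0, u) (0, v) (0, w)).2
      = fderivWithin ℝ (christoffel (fun y => h (x.1, y)) univ) univ x.2 u v w := by
  have hΓ := ((H.differentiableWithinAt_cylinderChristoffel hx).hasFDerivWithinAt.clm_apply
    (hasFDerivWithinAt_const ((0, v) : ℝ × E) x _)).clm_apply
    (hasFDerivWithinAt_const ((0, w) : ℝ × E) x _)
  have h1 := hasFDerivAt_slice_snd hx.1 hΓ.snd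
  have hV : V ∈ nhds x.2 := H.isOpen.mem_nhds hx.2
  have hslice : ContDiffOn ℝ ∞ (fun y => h (x.1, y)) V :=
    H.contDiffOn.comp (contDiff_prodMk_right x.1).contDiffOn fun y hy => ⟨hx.1, hy⟩
  have hD : DifferentiableWithinAt ℝ (christoffel (fun y => h (x.1, y)) univ) univ x.2 := by
    refine differentiableWithinAt_christoffel ?_ (H.isInvertible hx) ?_
    · exact ((hslice.differentiableOn (by simp)).differentiableAt hV).differentiableWithinAt
    · simp only [fderivWithin_univ]
      exact (((hslice.fderiv_of_isOpen (m := ∞) H.isOpen (by simp)).differentiableOn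
        (by simp)).differentiableAt hV).differentiableWithinAt
  have h2 := ((hD.hasFDerivWithinAt.clm_apply (hasFDerivWithinAt_const v x.2 _)).clm_apply
    (hasFDerivWithinAt_const w x.2 _)).hasFDerivAt Filter.univ_mem
  have h3 := h2.congr_of_eventuallyEq
    (f₁ := fun y => (cylinderChristoffel J h (x.1, y) (0, v) (0, w)).2)
    (by filter_upwards [hV] with y hy
        exact H.cylinderChristoffel_inr_inr (x := (x.1, y)) ⟨hx.1, hy⟩ v w)
  have := congrArg (fun L : E →L[ℝ] E => L u) (h1.unique h3)
  simpa using this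

/-- `W` is, by definition, minus the tangential part of `u ↦ Γ((0, u), (1, 0))`. -/
theorem fderivWithin_christoffel_snd_inl (H : IsChartFamily J V h) (hx : x ∈ J ×ˢ V)
    (U : ℝ × E) (u : E) :
    (fderivWithin ℝ (cylinderChristoffel J h) (J ×ˢ univ) x U (0, u) (1, 0)).2
      = -fderivWithin ℝ (chartWeingarten J h) (J ×ˢ univ) x U u := by
  have hu := H.uniqueDiffWithinAt hx
  have hΓ := ((H.differentiableWithinAt_cylinderChristoffel hx).hasFDerivWithinAt.clm_apply
    (hasFDerivWithinAt_const ((0, u) : ℝ × E) x _)).clm_apply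
    (hasFDerivWithinAt_const ((1, 0) : ℝ × E) x _)
  have hW := ((H.differentiableWithinAt_chartWeingarten hx).hasFDerivWithinAt.clm_apply
    (hasFDerivWithinAt_const u x _)).neg
  simp only [Pi.neg_def, chartWeingarten_apply, neg_neg] at hW
  have := congrArg (fun L : ℝ × E →L[ℝ] E => L U) (hu.eq hΓ.snd hW)
  simpa using this

theorem fderivWithin_christoffel_inl_inl (H : IsChartFamily J V h) (hx : x ∈ J ×ˢ V) (U : ℝ × E) :
    fderivWithin ℝ (cylinderChristoffel J h) (J ×ˢ univ) x U (1, 0) (1, 0) = 0 := by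
  have hu := H.uniqueDiffWithinAt hx
  have hΓ := H.differentiableWithinAt_cylinderChristoffel hx
  rw [fderivWithin_apply_apply hu hΓ]
  have h0 : fderivWithin ℝ (fun z => cylinderChristoffel J h z (1, 0) (1, 0)) (J ×ˢ univ) x
      = fderivWithin ℝ (fun _ => (0 : ℝ × E)) (J ×ˢ univ) x := by
    refine Filter.EventuallyEq.fderivWithin_eq ?_ ?_
    · filter_upwards [H.mem_nhdsWithin hx] with z hz using H.cylinderChristoffel_inl_inl hz 1 1
    · exact H.cylinderChristoffel_inl_inl hx 1 1
  simp [h0]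

/-- Differentiating `h(W u, v) = -1/2 ḣ(u, v)`. -/
theorem metric_fderivWithin_chartWeingarten (H : IsChartFamily J V h) (hx : x ∈ J ×ˢ V)
    (U : ℝ × E) (u v : E) :
    h x (fderivWithin ℝ (chartWeingarten J h) (J ×ˢ univ) x U u) v
      = -(1 / 2) * fderivWithin ℝ (chartDot J h) (J ×ˢ univ) x U u v
        - fderivWithin ℝ h (J ×ˢ univ) x U (chartWeingarten J h x u) v := by
  have hu := H.uniqueDiffWithinAt hx
  have hW := (H.differentiableWithinAt_chartWeingarten hx).hasFDerivWithinAt.clm_apply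
    (hasFDerivWithinAt_const u x _)
  have hh := (H.differentiableWithinAt_of_contDiffOn hx H.contDiffOn).hasFDerivWithinAt
  have h1 := (hh.clm_apply hW).clm_apply (hasFDerivWithinAt_const v x _)
  have hd := (((H.differentiableWithinAt_chartDot hx).hasFDerivWithinAt.clm_apply
    (hasFDerivWithinAt_const u x _)).clm_apply (hasFDerivWithinAt_const v x _)).const_mul (-(1 / 2))
  have h2 := h1.congr_of_eventuallyEq (f₁ := fun z => -(1 / 2) * chartDot J h z u v)
    (by filter_upwards [H.mem_nhdsWithin hx] with z hz
        exact (H.metric_chartWeingarten hz u v).symm)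
    (H.metric_chartWeingarten hx u v).symm
  have := congrArg (fun L : ℝ × E →L[ℝ] ℝ => L U) (hu.eq hd h2)
  simp at this
  linarith

/-- The tangential part of `R(u, v) w` for tangential vectors. -/
theorem cylinderCurvature_tangential_snd (H : IsChartFamily J V h) (hx : x ∈ J ×ˢ V) (u v w : E) :
    (cylinderCurvature J h x (0, u) (0, v) (0, w)).2 = sliceCurvature h x u v w
      + (1 / 2 * chartDot J h x v w) • chartWeingarten J h x u
      - (1 / 2 * chartDot J h x u w) • chartWeingarten J h x v := by
  simp only [cylinderCurvature_apply, sliceCurvature_apply, Prod.snd_add, Prod.snd_sub,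
    H.fderivWithin_christoffel_snd_inr hx, H.cylinderChristoffel_apply hx, zero_smul, sub_zero]
  module

/-- The Codazzi equation: the normal part of `R(u, v) w` for tangential vectors. -/
theorem cylinderCurvature_tangential_fst (H : IsChartFamily J V h) (hx : x ∈ J ×ˢ V) (u v w : E) :
    (cylinderCurvature J h x (0, u) (0, v) (0, w)).1 =
      1 / 2 * (chartCovDerivBilin (fun y => h (x.1, y)) univ (fun y => chartDot J h (x.1, y))
          x.2 v u w
        - chartCovDerivBilin (fun y => h (x.1, y)) univ (fun y => chartDot J h (x.1, y))
          x.2 u v w) := by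
  have hs : christoffel (fun y => h (x.1, y)) univ x.2 u v
      = christoffel (fun y => h (x.1, y)) univ x.2 v u := H.sliceChristoffel_symm hx u v
  simp only [cylinderCurvature_apply, Prod.fst_add, Prod.fst_sub,
    H.fderivWithin_christoffel_fst hx, H.cylinderChristoffel_apply hx, chartCovDerivBilin,
    fderivWithin_slice hx.1 (H.differentiableWithinAt_chartDot hx), hs]
  simp only [sliceChristoffel, Prod.mk.eta]
  simp
  ring

/-- The curvature operator `u ↦ R(u, ν) ν`. -/
theorem cylinderCurvature_normal_normal (H : IsChartFamily J V h) (hx : x ∈ J ×ˢ V) (u : E) :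
    cylinderCurvature J h x (0, u) (1, 0) (1, 0) =
      (0, fderivWithin ℝ (chartWeingarten J h) (J ×ˢ univ) x (1, 0) u
        - chartWeingarten J h x (chartWeingarten J h x u)) := by
  ext
  · simp [cylinderCurvature_apply, H.fderivWithin_christoffel_fst hx,
      H.cylinderChristoffel_apply hx]
  · simp only [cylinderCurvature_apply, Prod.snd_add, Prod.snd_sub,
      H.fderivWithin_christoffel_inl_inl hx, H.fderivWithin_christoffel_snd_inl hx,
      H.cylinderChristoffel_apply hx]
    simp

/-- The curvature `R(u, v) ν` for tangential vectors: its tangential part. -/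
theorem cylinderCurvature_tangential_normal_snd (H : IsChartFamily J V h) (hx : x ∈ J ×ˢ V)
    (u v : E) :
    (cylinderCurvature J h x (0, u) (0, v) (1, 0)).2 =
      fderivWithin ℝ (chartWeingarten J h) (J ×ˢ univ) x (0, v) u
      - fderivWithin ℝ (chartWeingarten J h) (J ×ˢ univ) x (0, u) v
      + sliceChristoffel h x v (chartWeingarten J h x u)
      - sliceChristoffel h x u (chartWeingarten J h x v) := by
  simp only [cylinderCurvature_apply, Prod.snd_add, Prod.snd_sub,
      H.fderivWithin_christoffel_snd_inl hx, H.cylinderChristoffel_apply hx]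
  simp
  abel

/-- The normal part of `R(ν, u) ν`, which is the contribution of `ν` to the trace `ric(u, ν)`. -/
theorem cylinderCurvature_normal_tangential_normal_fst (H : IsChartFamily J V h)
    (hx : x ∈ J ×ˢ V) (u : E) :
    (cylinderCurvature J h x (1, 0) (0, u) (1, 0)).1 = 0 := by
  simp [cylinderCurvature_apply, H.fderivWithin_christoffel_fst hx, H.cylinderChristoffel_apply hx]

/-- The normal part of `R(ν, u) v`, which is the contribution of `ν` to the trace `ric(u, v)`. -/
theorem cylinderCurvature_normal_tangential_fst (H : IsChartFamily J V h) (hx : x ∈ J ×ˢ V)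
    (u v : E) :
    (cylinderCurvature J h x (1, 0) (0, u) (0, v)).1 =
      -(1 / 2) * chartDDot J h x u v
        + h x (chartWeingarten J h x u) (chartWeingarten J h x v) := by
  simp only [cylinderCurvature_apply, Prod.fst_add, Prod.fst_sub,
    H.fderivWithin_christoffel_fst hx, H.cylinderChristoffel_apply hx, ← H.chartDDot_eq hx]
  simp [H.chartDot_eq_metric_chartWeingarten hx]

end IsChartFamily
end ChartCurvature

/-! ### Metric contractions, Ricci and scalar curvature in a chart -/

section Traces

variable {F : Type*} [NormedAddCommGroup F] [NormedSpace ℝ F]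

/-- The Ricci form `(u, v) ↦ tr (w ↦ R(w, u) v)` in a chart. -/
def chartRicci (G : F → F →L[ℝ] F →L[ℝ] ℝ) (S : Set F) (y : F) : F →ₗ[ℝ] F →ₗ[ℝ] ℝ :=
  LinearMap.mk₂ ℝ (fun u v => LinearMap.trace ℝ F
      ((((chartCurvature G S y).flip u).flip v : F →L[ℝ] F) : F →ₗ[ℝ] F))
    (fun u u' v => by rw [← map_add]; congr 1; ext w; simp)
    (fun c u v => by rw [← map_smul]; congr 1; ext w; simp)
    (fun u v v' => by rw [← map_add]; congr 1; ext w; simp)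
    (fun c u v => by rw [← map_smul]; congr 1; ext w; simp)

theorem apply_sharp {k : F →L[ℝ] F →L[ℝ] ℝ} (hk : k.IsInvertible) (α : F →L[ℝ] ℝ) (u : F) :
    k (sharp k α) u = α u := by
  rw [sharp, hk.self_apply_inverse]

variable [FiniteDimensional ℝ F]

theorem trace_eq_sum_finBasis (A : F →ₗ[ℝ] F) :
    LinearMap.trace ℝ F A = ∑ i, (Module.finBasis ℝ F).coord i (A (Module.finBasis ℝ F i)) := by
  rw [LinearMap.trace_eq_matrix_trace ℝ (Module.finBasis ℝ F)]
  simp [Matrix.trace, LinearMap.toMatrix_apply]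

/-- The metric contraction of `(u, v) ↦ k(A u, v)` is the trace of `A`. -/
theorem metricContraction_eq_trace {k : F →L[ℝ] F →L[ℝ] ℝ} (hk : k.IsInvertible)
    (hs : ∀ u v, k u v = k v u) {B : F → F → ℝ} (A : F →L[ℝ] F) (hA : ∀ u v, B u v = k (A u) v) :
    metricContraction k B = LinearMap.trace ℝ F (A : F →ₗ[ℝ] F) := by
  rw [trace_eq_sum_finBasis, metricContraction]
  refine Finset.sum_congr rfl fun i _ => ?_
  rw [hA, hs, apply_sharp hk]
  rfl

theorem metricContraction_add (k : F →L[ℝ] F →L[ℝ] ℝ) (B B' : F → F → ℝ) :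
    metricContraction k (fun u v => B u v + B' u v)
      = metricContraction k B + metricContraction k B' := by
  simp [metricContraction, Finset.sum_add_distrib]

theorem metricContraction_const_mul (k : F →L[ℝ] F →L[ℝ] ℝ) (c : ℝ) (B : F → F → ℝ) :
    metricContraction k (fun u v => c * B u v) = c * metricContraction k B := by
  simp [metricContraction, Finset.mul_sum]

/-- Raising an index: a bilinear form is represented by an endomorphism. -/
theorem exists_endomorphism_of_bilin {k : F →L[ℝ] F →L[ℝ] ℝ} (hk : k.IsInvertible)
    (B : F →ₗ[ℝ] F →ₗ[ℝ] ℝ) : ∃ A : F →L[ℝ] F, ∀ u v, B u v = k (A u) v := by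
  let B' : F →L[ℝ] F →L[ℝ] ℝ := LinearMap.toContinuousLinearMap
    ((LinearMap.toContinuousLinearMap (𝕜 := ℝ) (E := F) (F' := ℝ)).toLinearMap ∘ₗ B)
  refine ⟨k.inverse ∘L B', fun u v => ?_⟩
  rw [ContinuousLinearMap.comp_apply, hk.self_apply_inverse]
  rfl

end Traces

section CylinderTraces

variable {E : Type*} [NormedAddCommGroup E] [NormedSpace ℝ E] [FiniteDimensional ℝ E]

/-- The trace of an endomorphism of `ℝ × E` is the sum of the traces of its diagonal blocks. -/
theorem trace_prod_real (A : ℝ × E →L[ℝ] ℝ × E) :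
    LinearMap.trace ℝ (ℝ × E) (A : ℝ × E →ₗ[ℝ] ℝ × E) = (A (1, 0)).1
      + LinearMap.trace ℝ E ((ContinuousLinearMap.snd ℝ ℝ E ∘L A ∘L
          ContinuousLinearMap.inr ℝ ℝ E : E →L[ℝ] E) : E →ₗ[ℝ] E) := by
  have h1 : (A : ℝ × E →ₗ[ℝ] ℝ × E)
      = ((A : ℝ × E →ₗ[ℝ] ℝ × E) ∘ₗ LinearMap.inl ℝ ℝ E) ∘ₗ LinearMap.fst ℝ ℝ E
        + ((A : ℝ × E →ₗ[ℝ] ℝ × E) ∘ₗ LinearMap.inr ℝ ℝ E) ∘ₗ LinearMap.snd ℝ ℝ E := by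
    refine LinearMap.ext fun z => ?_
    simp [← map_add]
  have h2 : LinearMap.trace ℝ ℝ
      (LinearMap.fst ℝ ℝ E ∘ₗ (A : ℝ × E →ₗ[ℝ] ℝ × E) ∘ₗ LinearMap.inl ℝ ℝ E)
        = (A (1, 0)).1 := by
    rw [LinearMap.trace_eq_matrix_trace ℝ (Module.Basis.singleton Unit ℝ)]
    simp [Matrix.trace, LinearMap.toMatrix_apply]
  conv_lhs => rw [h1]
  rw [map_add, LinearMap.trace_comp_comm', h2, LinearMap.trace_comp_comm']
  rfl

/-- Contraction with respect to `dt² + k` is the value at `ν` plus the contraction with respect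
to `k`. -/
theorem metricContraction_cylinderForm {k : E →L[ℝ] E →L[ℝ] ℝ}
    (hk : ∀ u, (∀ v, k u v = 0) → u = 0) (hs : ∀ u v, k u v = k v u)
    (B : ℝ × E →ₗ[ℝ] ℝ × E →ₗ[ℝ] ℝ) :
    metricContraction (cylinderForm k) (fun u v => B u v)
      = B (1, 0) (1, 0) + metricContraction k (fun u v => B (0, u) (0, v)) := by
  have hinv := isInvertible_of_nondegenerate (nondegenerate_cylinderForm hk)
  obtain ⟨A, hA⟩ := exists_endomorphism_of_bilin hinv B
  rw [metricContraction_eq_trace hinv (fun u v => by simp [hs u.2, mul_comm]) A hA,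
    trace_prod_real, metricContraction_eq_trace (isInvertible_of_nondegenerate hk) hs
      (ContinuousLinearMap.snd ℝ ℝ E ∘L A ∘L ContinuousLinearMap.inr ℝ ℝ E)
      (fun u v => by simp [hA]), hA]
  simp

/-- The Ricci form of `dt² + h_t` on `J × E`. -/
def cylinderRicci (J : Set ℝ) (h : ℝ × E → E →L[ℝ] E →L[ℝ] ℝ) (x : ℝ × E) :
    ℝ × E →ₗ[ℝ] ℝ × E →ₗ[ℝ] ℝ :=
  chartRicci (fun z => cylinderForm (h z)) (J ×ˢ univ) x

/-- The Ricci form as a trace, split into its normal and its tangential part. -/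
theorem cylinderRicci_apply (J : Set ℝ) (h : ℝ × E → E →L[ℝ] E →L[ℝ] ℝ) (x A B : ℝ × E) :
    cylinderRicci J h x A B = (cylinderCurvature J h x (1, 0) A B).1
      + LinearMap.trace ℝ E ((ContinuousLinearMap.snd ℝ ℝ E ∘L
          ((cylinderCurvature J h x).flip A).flip B ∘L
          ContinuousLinearMap.inr ℝ ℝ E : E →L[ℝ] E) : E →ₗ[ℝ] E) := by
  have := trace_prod_real (((cylinderCurvature J h x).flip A).flip B)
  exact this

namespace IsChartFamily

variable {J : Set ℝ} {V : Set E} {h : ℝ × E → E →L[ℝ] E →L[ℝ] ℝ} {x : ℝ × E}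

/-- The metric trace of the second derivative of the metric. -/
theorem metricContraction_chartDDot (H : IsChartFamily J V h) (hx : x ∈ J ×ˢ V) :
    metricContraction (h x) (fun u v => chartDDot J h x u v) =
      4 * LinearMap.trace ℝ E ((chartWeingarten J h x ∘L chartWeingarten J h x : E →L[ℝ] E)
          : E →ₗ[ℝ] E)
      - 2 * LinearMap.trace ℝ E ((fderivWithin ℝ (chartWeingarten J h) (J ×ˢ univ) x (1, 0)
          : E →L[ℝ] E) : E →ₗ[ℝ] E) := by
  rw [metricContraction_eq_trace (H.isInvertible hx) (H.symm x hx)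
    ((4 : ℝ) • (chartWeingarten J h x ∘L chartWeingarten J h x)
      - (2 : ℝ) • fderivWithin ℝ (chartWeingarten J h) (J ×ˢ univ) x (1, 0)) fun u v => ?_]
  · simp
  · simp [H.metric_fderivWithin_chartWeingarten hx, ← H.chartDDot_eq hx, ← H.chartDot_eq hx,
      H.chartDot_eq_metric_chartWeingarten hx]
    ring

theorem cylinderRicci_normal_normal (H : IsChartFamily J V h) (hx : x ∈ J ×ˢ V) :
    cylinderRicci J h x (1, 0) (1, 0) =
      LinearMap.trace ℝ E ((chartWeingarten J h x ∘L chartWeingarten J h x : E →L[ℝ] E)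
          : E →ₗ[ℝ] E)
      - 1 / 2 * metricContraction (h x) (fun u v => chartDDot J h x u v) := by
  have h1 : (ContinuousLinearMap.snd ℝ ℝ E ∘L
      ((cylinderCurvature J h x).flip (1, 0)).flip (1, 0) ∘L ContinuousLinearMap.inr ℝ ℝ E)
      = fderivWithin ℝ (chartWeingarten J h) (J ×ˢ univ) x (1, 0)
        - chartWeingarten J h x ∘L chartWeingarten J h x := by
    ext u
    simp [H.cylinderCurvature_normal_normal hx]
  have h2 : (cylinderCurvature J h x (1, 0) (1, 0) (1, 0)).1 = 0 := by
    simp [cylinderCurvature_apply]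
  rw [H.metricContraction_chartDDot hx, cylinderRicci_apply, h1, h2]
  simp
  ring

theorem cylinderRicci_tangential (H : IsChartFamily J V h) (hx : x ∈ J ×ˢ V) (u v : E) :
    cylinderRicci J h x (0, u) (0, v) = chartRicci (fun y => h (x.1, y)) univ x.2 u v
      + 2 * h x (chartWeingarten J h x u) (chartWeingarten J h x v)
      - LinearMap.trace ℝ E (chartWeingarten J h x : E →ₗ[ℝ] E) * h x (chartWeingarten J h x u) v
      - 1 / 2 * chartDDot J h x u v := by
  have h1 : (ContinuousLinearMap.snd ℝ ℝ E ∘L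
      ((cylinderCurvature J h x).flip (0, u)).flip (0, v) ∘L ContinuousLinearMap.inr ℝ ℝ E)
      = ((sliceCurvature h x).flip u).flip v
        + (1 / 2 * chartDot J h x u v) • chartWeingarten J h x
        - (1 / 2 : ℝ) • ((chartDot J h x).flip v).smulRight (chartWeingarten J h x u) := by
    ext w
    simp [H.cylinderCurvature_tangential_snd hx, mul_smul]
  have h2 : LinearMap.trace ℝ E ((((chartDot J h x).flip v).smulRight (chartWeingarten J h x u)
      : E →L[ℝ] E) : E →ₗ[ℝ] E) = chartDot J h x (chartWeingarten J h x u) v :=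
    LinearMap.trace_smulRight _ _
  have h3 : LinearMap.trace ℝ E ((((sliceCurvature h x).flip u).flip v : E →L[ℝ] E) : E →ₗ[ℝ] E)
      = chartRicci (fun y => h (x.1, y)) univ x.2 u v := rfl
  rw [cylinderRicci_apply, h1, H.cylinderCurvature_normal_tangential_fst hx]
  push_cast
  rw [map_sub, map_add, map_smul, map_smul, h2, h3, H.chartDot_eq_metric_chartWeingarten hx,
    H.chartDot_eq_metric_chartWeingarten hx, H.metric_chartWeingarten_symm hx
    (chartWeingarten J h x u)]
  simp only [smul_eq_mul]
  ring

theorem scalar_cylinder (H : IsChartFamily J V h) (hx : x ∈ J ×ˢ V) :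
    metricContraction (cylinderForm (h x)) (fun A B => cylinderRicci J h x A B) =
      metricContraction (h x) (fun u v => chartRicci (fun y => h (x.1, y)) univ x.2 u v)
      + 3 * LinearMap.trace ℝ E ((chartWeingarten J h x ∘L chartWeingarten J h x : E →L[ℝ] E)
          : E →ₗ[ℝ] E)
      - LinearMap.trace ℝ E (chartWeingarten J h x : E →ₗ[ℝ] E) ^ 2
      - metricContraction (h x) (fun u v => chartDDot J h x u v) := by
  have h1 : metricContraction (h x) (fun u v => h x (chartWeingarten J h x u) v)
      = LinearMap.trace ℝ E (chartWeingarten J h x : E →ₗ[ℝ] E) :=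
    metricContraction_eq_trace (H.isInvertible hx) (H.symm x hx) _ fun _ _ => rfl
  have h2 : metricContraction (h x)
      (fun u v => h x (chartWeingarten J h x u) (chartWeingarten J h x v))
      = LinearMap.trace ℝ E ((chartWeingarten J h x ∘L chartWeingarten J h x : E →L[ℝ] E)
          : E →ₗ[ℝ] E) :=
    metricContraction_eq_trace (H.isInvertible hx) (H.symm x hx) _ fun u v => by
      rw [← H.metric_chartWeingarten_symm hx]; rfl
  rw [metricContraction_cylinderForm (H.nondegenerate x hx) (H.symm x hx),
    H.cylinderRicci_normal_normal hx]
  simp only [H.cylinderRicci_tangential hx, sub_eq_add_neg, ← neg_mul, metricContraction_add,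
    metricContraction_const_mul, h1, h2]
  ring

/-- The Levi-Civita connection of the slice is metric. -/
theorem fderivWithin_metric (H : IsChartFamily J V h) (hx : x ∈ J ×ˢ V) (u v w : E) :
    fderivWithin ℝ h (J ×ˢ univ) x (0, u) v w
      = h x (sliceChristoffel h x u v) w + h x v (sliceChristoffel h x u w) := by
  rw [H.symm x hx v, H.koszul_slice hx, H.koszul_slice hx, H.symm_fderivWithin hx (0, u) w v]
  ring

/-- `∇ W` for the Weingarten map of the slice. -/
theorem chartCovDerivEnd_chartWeingarten (H : IsChartFamily J V h) (hx : x ∈ J ×ˢ V) (u v : E) :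
    chartCovDerivEnd (fun y => h (x.1, y)) univ (fun y => chartWeingarten J h (x.1, y)) x.2 u v
      = fderivWithin ℝ (chartWeingarten J h) (J ×ˢ univ) x (0, u) v
        + sliceChristoffel h x u (chartWeingarten J h x v)
        - chartWeingarten J h x (sliceChristoffel h x u v) := by
  rw [chartCovDerivEnd, fderivWithin_slice hx.1 (H.differentiableWithinAt_chartWeingarten hx)]
  rfl

/-- `∇_u W` is self-adjoint, because `W` is and the connection is metric. -/
theorem chartCovDerivEnd_selfAdjoint (H : IsChartFamily J V h) (hx : x ∈ J ×ˢ V) (u v w : E) :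
    h x (chartCovDerivEnd (fun y => h (x.1, y)) univ
        (fun y => chartWeingarten J h (x.1, y)) x.2 u v) w
      = h x v (chartCovDerivEnd (fun y => h (x.1, y)) univ
        (fun y => chartWeingarten J h (x.1, y)) x.2 u w) := by
  have hd : fderivWithin ℝ (chartDot J h) (J ×ˢ univ) x (0, u) v w
      = fderivWithin ℝ (chartDot J h) (J ×ˢ univ) x (0, u) w v := by
    have hu := H.uniqueDiffWithinAt hx
    have hD := H.differentiableWithinAt_chartDot hx
    rw [fderivWithin_apply_apply hu hD, fderivWithin_apply_apply hu hD]
    refine congrArg (fun L : ℝ × E →L[ℝ] ℝ => L (0, u)) (Filter.EventuallyEq.fderivWithin_eq ?_ ?_)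
    · filter_upwards [H.mem_nhdsWithin hx] with z hz using H.chartDot_symm hz v w
    · exact H.chartDot_symm hx v w
  rw [H.symm x hx v]
  simp only [H.chartCovDerivEnd_chartWeingarten hx, map_add, map_sub, add_apply,
    sub_apply, H.metric_fderivWithin_chartWeingarten hx, H.fderivWithin_metric hx, hd,
    H.metric_chartWeingarten_symm hx (sliceChristoffel h x u _)]
  rw [H.symm x hx (chartWeingarten J h x v) (sliceChristoffel h x u w),
    H.symm x hx (chartWeingarten J h x w) (sliceChristoffel h x u v)]
  ring

/-- The divergence of `W`, paired with `v`, is the trace of `u ↦ (∇_u W) v`. -/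
theorem metric_divergence (H : IsChartFamily J V h) (hx : x ∈ J ×ˢ V) (v : E) :
    h x (metricContraction (h x) (chartCovDerivEnd (fun y => h (x.1, y)) univ
        (fun y => chartWeingarten J h (x.1, y)) x.2)) v
      = LinearMap.trace ℝ E (((fderivWithin ℝ (chartWeingarten J h) (J ×ˢ univ) x ∘L
            ContinuousLinearMap.inr ℝ ℝ E).flip v
          + (sliceChristoffel h x).flip (chartWeingarten J h x v)
          - chartWeingarten J h x ∘L (sliceChristoffel h x).flip v : E →L[ℝ] E) : E →ₗ[ℝ] E) := by
  rw [trace_eq_sum_finBasis, metricContraction, map_sum, sum_apply]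
  refine Finset.sum_congr rfl fun i _ => ?_
  rw [H.chartCovDerivEnd_selfAdjoint hx, apply_sharp (H.isInvertible hx),
    H.chartCovDerivEnd_chartWeingarten hx]
  rfl

/-- The terms containing the Christoffel map in the trace of `w ↦ R(w, u) ν` and in the divergence
of `W` agree because `tr (Γ(u) W) = tr (W Γ(u))`. -/
theorem cylinderRicci_tangential_normal (H : IsChartFamily J V h) (hx : x ∈ J ×ˢ V) (u : E) :
    cylinderRicci J h x (0, u) (1, 0) =
      LinearMap.trace ℝ E ((fderivWithin ℝ (chartWeingarten J h) (J ×ˢ univ) x (0, u) : E →L[ℝ] E)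
        : E →ₗ[ℝ] E)
      - h x (metricContraction (h x) (chartCovDerivEnd (fun y => h (x.1, y)) univ
          (fun y => chartWeingarten J h (x.1, y)) x.2)) u := by
  have h1 : (ContinuousLinearMap.snd ℝ ℝ E ∘L
      ((cylinderCurvature J h x).flip (0, u)).flip (1, 0) ∘L ContinuousLinearMap.inr ℝ ℝ E)
      = fderivWithin ℝ (chartWeingarten J h) (J ×ˢ univ) x (0, u)
      - (fderivWithin ℝ (chartWeingarten J h) (J ×ˢ univ) x ∘L
            ContinuousLinearMap.inr ℝ ℝ E).flip u
      + sliceChristoffel h x u ∘L chartWeingarten J h x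
      - (sliceChristoffel h x).flip (chartWeingarten J h x u) := by
    ext w
    simp [H.cylinderCurvature_tangential_normal_snd hx]
  have h2 : LinearMap.trace ℝ E ((sliceChristoffel h x u ∘L chartWeingarten J h x : E →L[ℝ] E)
      : E →ₗ[ℝ] E) = LinearMap.trace ℝ E
        ((chartWeingarten J h x ∘L (sliceChristoffel h x).flip u : E →L[ℝ] E) : E →ₗ[ℝ] E) := by
    have h3 : (sliceChristoffel h x).flip u = sliceChristoffel h x u := by
      ext w
      exact H.sliceChristoffel_symm hx w u
    rw [h3]
    exact LinearMap.trace_comp_comm' _ _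
  rw [cylinderRicci_apply, h1, H.cylinderCurvature_normal_tangential_normal_fst hx,
    H.metric_divergence hx]
  push_cast
  rw [map_sub, map_add, map_sub, map_sub, map_add]
  have h4 := h2
  push_cast at h4
  rw [h4]
  ring

end IsChartFamily
end CylinderTraces

/-! ### Coordinate frames of `M` and of `ℝ × M` -/

section Frames

variable {F : Type*} [NormedAddCommGroup F] [NormedSpace ℝ F]
  {H : Type*} [TopologicalSpace H] (I : ModelWithCorners ℝ F H)
  {N : Type*} [TopologicalSpace N] [ChartedSpace H N]

/-- The tangent space at `p` is identified with the model space through the chart at `p` itself. -/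
theorem chartFrame_self [IsManifold I 1 N] (p : N) (u : F) :
    chartFrame I p (extChartAt I p p) u = u :=
  congrArg (fun L : F →L[ℝ] F => L u) (mfderivWithin_range_extChartAt_symm (I := I) (x := p))

theorem isInvertible_chartFrame [IsManifold I 1 N] (p : N) {y : F}
    (hy : y ∈ (extChartAt I p).target) : (chartFrame I p y).IsInvertible :=
  isInvertible_mfderivWithin_extChartAt_symm hy

theorem chartBilin_self [IsManifold I 1 N]
    (h : Π q : N, TangentSpace I q →L[ℝ] TangentSpace I q →L[ℝ] ℝ) (p : N) :
    chartBilin I h p (extChartAt I p p) = h p := by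
  have h1 : ∀ u v : F, chartBilin I h p (extChartAt I p p) u v
      = (h ((extChartAt I p).symm (extChartAt I p p)) : F →L[ℝ] F →L[ℝ] ℝ) u v := fun u v =>
    congrArg₂ (fun a b : F => (h ((extChartAt I p).symm (extChartAt I p p)) :
      F →L[ℝ] F →L[ℝ] ℝ) a b) (chartFrame_self I p u) (chartFrame_self I p v)
  let h' : N → (F →L[ℝ] F →L[ℝ] ℝ) := h
  have h2 : h' ((extChartAt I p).symm (extChartAt I p p)) = h' p :=
    congrArg h' (extChartAt_to_inv (I := I) p)
  refine ContinuousLinearMap.ext fun u => ContinuousLinearMap.ext fun v => ?_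
  exact (h1 u v).trans (congrArg (fun k : F →L[ℝ] F →L[ℝ] ℝ => k u v) h2)

theorem chartSet_univ (p : N) : chartSet I (univ : Set N) p = range I := by
  simp [chartSet]

end Frames

section ProductFrames

variable {E : Type*} [NormedAddCommGroup E] [NormedSpace ℝ E]
  {M : Type*} [TopologicalSpace M] [ChartedSpace E M]

theorem extChartAt_cylinder_symm_apply (z : ℝ × M) (x : ℝ × E) :
    (extChartAt (𝓘(ℝ, ℝ).prod 𝓘(ℝ, E)) z).symm x = (x.1, (extChartAt 𝓘(ℝ, E) z.2).symm x.2) := by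
  rw [extChartAt_prod]
  rfl

theorem extChartAt_cylinder_apply (z w : ℝ × M) :
    extChartAt (𝓘(ℝ, ℝ).prod 𝓘(ℝ, E)) z w = (w.1, extChartAt 𝓘(ℝ, E) z.2 w.2) := by
  rw [extChartAt_prod]
  rfl

theorem chartSet_cylinder (J : Set ℝ) (z : ℝ × M) :
    chartSet (𝓘(ℝ, ℝ).prod 𝓘(ℝ, E)) (J ×ˢ (univ : Set M)) z = J ×ˢ univ := by
  ext x
  have h1 : x ∈ chartSet (𝓘(ℝ, ℝ).prod 𝓘(ℝ, E)) (J ×ˢ (univ : Set M)) z ↔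
      (extChartAt (𝓘(ℝ, ℝ).prod 𝓘(ℝ, E)) z).symm x ∈ J ×ˢ (univ : Set M) ∧
        x ∈ range (𝓘(ℝ, ℝ).prod 𝓘(ℝ, E)) := Iff.rfl
  rw [h1, extChartAt_cylinder_symm_apply]
  simp

variable [IsManifold 𝓘(ℝ, E) 1 M]

/-- The coordinate frame of `ℝ × M` is the product of that of `ℝ` and that of `M`. -/
theorem chartFrame_cylinder (z : ℝ × M) {x : ℝ × E} (hx : x.2 ∈ (extChartAt 𝓘(ℝ, E) z.2).target)
    (u : ℝ × E) :
    (chartFrame (𝓘(ℝ, ℝ).prod 𝓘(ℝ, E)) z x u : ℝ × E)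
      = (u.1, (chartFrame 𝓘(ℝ, E) z.2 x.2 u.2 : E)) := by
  have h0 : HasMFDerivAt 𝓘(ℝ, E) 𝓘(ℝ, E) (extChartAt 𝓘(ℝ, E) z.2).symm x.2
      (chartFrame 𝓘(ℝ, E) z.2 x.2) := by
    have := (mdifferentiableWithinAt_extChartAt_symm hx).hasMFDerivWithinAt
    simpa [chartFrame] using this
  have h1 : HasMFDerivAt 𝓘(ℝ, ℝ × E) 𝓘(ℝ, E)
      (fun w : ℝ × E => (extChartAt 𝓘(ℝ, E) z.2).symm w.2) x
      ((chartFrame 𝓘(ℝ, E) z.2 x.2).comp (ContinuousLinearMap.snd ℝ ℝ E)) :=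
    HasMFDerivAt.comp x h0 (hasFDerivAt_snd (𝕜 := ℝ) (p := x)).hasMFDerivAt
  have h2 : HasMFDerivAt 𝓘(ℝ, ℝ × E) 𝓘(ℝ, ℝ) (fun w : ℝ × E => w.1) x
      (ContinuousLinearMap.fst ℝ ℝ E) := (hasFDerivAt_fst (𝕜 := ℝ) (p := x)).hasMFDerivAt
  have h3 := h2.prodMk h1
  have h4 : (extChartAt (𝓘(ℝ, ℝ).prod 𝓘(ℝ, E)) z).symm
      = fun w : ℝ × E => (w.1, (extChartAt 𝓘(ℝ, E) z.2).symm w.2) :=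
    funext fun w => extChartAt_cylinder_symm_apply z w
  have h5 : range (𝓘(ℝ, ℝ).prod 𝓘(ℝ, E)) = (univ : Set (ℝ × E)) := by simp
  have h6 := h3.mfderiv
  have h7 : (chartFrame (𝓘(ℝ, ℝ).prod 𝓘(ℝ, E)) z x : ℝ × E →L[ℝ] ℝ × E)
      = mfderiv 𝓘(ℝ, ℝ × E) (𝓘(ℝ, ℝ).prod 𝓘(ℝ, E))
        (fun w : ℝ × E => (w.1, (extChartAt 𝓘(ℝ, E) z.2).symm w.2)) x := by
    unfold chartFrame
    rw [h4, h5, mfderivWithin_univ]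
  have h8 := congrArg (fun L : ℝ × E →L[ℝ] ℝ × E => L u) (h7.trans h6)
  exact h8

theorem chartBilin_cylinder
    (g : ℝ → Π p : M, TangentSpace 𝓘(ℝ, E) p →L[ℝ] TangentSpace 𝓘(ℝ, E) p →L[ℝ] ℝ)
    (z : ℝ × M) {x : ℝ × E} (hx : x.2 ∈ (extChartAt 𝓘(ℝ, E) z.2).target) :
    chartBilin (𝓘(ℝ, ℝ).prod 𝓘(ℝ, E)) (cylinderMetric g) z x
      = cylinderForm (chartBilin 𝓘(ℝ, E) (g x.1) z.2 x.2) := by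
  refine ContinuousLinearMap.ext fun u => ContinuousLinearMap.ext fun v => ?_
  have h1 : ∀ (w : ℝ × M) (a b : ℝ × E),
      (cylinderMetric g w : ℝ × E →L[ℝ] ℝ × E →L[ℝ] ℝ) a b
        = a.1 * b.1 + (g w.1 w.2 : E →L[ℝ] E →L[ℝ] ℝ) a.2 b.2 := fun w a b =>
    cylinderForm_apply _ _ _
  have h2 : chartBilin (𝓘(ℝ, ℝ).prod 𝓘(ℝ, E)) (cylinderMetric g) z x u v
      = (cylinderMetric g ((extChartAt (𝓘(ℝ, ℝ).prod 𝓘(ℝ, E)) z).symm x) :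
        ℝ × E →L[ℝ] ℝ × E →L[ℝ] ℝ) (chartFrame (𝓘(ℝ, ℝ).prod 𝓘(ℝ, E)) z x u)
          (chartFrame (𝓘(ℝ, ℝ).prod 𝓘(ℝ, E)) z x v) := rfl
  refine h2.trans ((h1 _ _ _).trans ?_)
  rw [chartFrame_cylinder z hx, chartFrame_cylinder z hx, extChartAt_cylinder_symm_apply,
    cylinderForm_apply]
  rfl

/-- `ν` is the first coordinate vector field in every chart. -/
theorem chartField_nu (z : ℝ × M) {x : ℝ × E} (hx : x.2 ∈ (extChartAt 𝓘(ℝ, E) z.2).target) :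
    chartField (𝓘(ℝ, ℝ).prod 𝓘(ℝ, E)) (nu (E := E) (M := M)) z x = (1, 0) := by
  have hx' : x ∈ (extChartAt (𝓘(ℝ, ℝ).prod 𝓘(ℝ, E)) z).target := by
    rw [extChartAt_prod]
    exact ⟨by rw [extChartAt_model_space_eq_id]; exact mem_univ x.1, hx⟩
  have h1 := isInvertible_chartFrame (𝓘(ℝ, ℝ).prod 𝓘(ℝ, E)) z hx'
  have h2 : nu (E := E) ((extChartAt (𝓘(ℝ, ℝ).prod 𝓘(ℝ, E)) z).symm x)
      = chartFrame (𝓘(ℝ, ℝ).prod 𝓘(ℝ, E)) z x ((1, 0) : ℝ × E) := by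
    have := chartFrame_cylinder z hx (1, 0)
    have h0 : (chartFrame 𝓘(ℝ, E) z.2 x.2 ((1, 0) : ℝ × E).2 : E) = 0 :=
      map_zero (chartFrame 𝓘(ℝ, E) z.2 x.2)
    rw [h0] at this
    exact this.symm
  rw [chartField, h2, h1.inverse_apply_self]

end ProductFrames

/-! ### A smooth family of metrics read in a chart -/

section Smoothness

variable {E : Type*} [NormedAddCommGroup E] [NormedSpace ℝ E]
  {M : Type*} [TopologicalSpace M] [ChartedSpace E M] [IsManifold 𝓘(ℝ, E) ∞ M]

/-- The metrics `g_s` read in the chart at `p`, as a function of `s` and of the chart point. -/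
def chartFamily
    (g : ℝ → Π p : M, TangentSpace 𝓘(ℝ, E) p →L[ℝ] TangentSpace 𝓘(ℝ, E) p →L[ℝ] ℝ) (p : M)
    (x : ℝ × E) : E →L[ℝ] E →L[ℝ] ℝ :=
  chartBilin 𝓘(ℝ, E) (g x.1) p x.2

/-- The coordinate vector fields are smooth sections of the tangent bundle. -/
theorem contMDiffOn_chartFrame (p : M) (v : E) :
    ContMDiffOn 𝓘(ℝ, E) (𝓘(ℝ, E).prod 𝓘(ℝ, E)) ∞
      (fun y => Bundle.TotalSpace.mk' E (E := fun q : M => TangentSpace 𝓘(ℝ, E) q)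
        ((extChartAt 𝓘(ℝ, E) p).symm y) (chartFrame 𝓘(ℝ, E) p y v))
      (extChartAt 𝓘(ℝ, E) p).target := by
  have : IsManifold 𝓘(ℝ, E) (∞ + 1) M := by simpa
  let e := trivializationAt E (TangentSpace 𝓘(ℝ, E) : M → Type _) p
  have hs := (contMDiffOn_extChartAt_symm (I := 𝓘(ℝ, E)) (n := ∞) p)
  have h1 : ContMDiffOn 𝓘(ℝ, E) (𝓘(ℝ, E).prod 𝓘(ℝ, E)) ∞
      (fun y => (((extChartAt 𝓘(ℝ, E) p).symm y, v) : M × E)) (extChartAt 𝓘(ℝ, E) p).target :=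
    hs.prodMk contMDiffOn_const
  have hmem : ∀ y ∈ (extChartAt 𝓘(ℝ, E) p).target,
      (extChartAt 𝓘(ℝ, E) p).symm y ∈ (chartAt E p).source := fun y hy => by
    rw [← extChartAt_source 𝓘(ℝ, E)]
    exact (extChartAt 𝓘(ℝ, E) p).map_target hy
  have h2 := (e.contMDiffOn_symm (IB := 𝓘(ℝ, E)) (n := ∞)).comp h1 fun y hy => by
    rw [mem_preimage, e.mem_target]
    exact hmem y hy
  refine h2.congr fun y hy => ?_
  have h3 : e.symmL ℝ ((extChartAt 𝓘(ℝ, E) p).symm y) = chartFrame 𝓘(ℝ, E) p y := by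
    have := TangentBundle.symmL_trivializationAt (I := 𝓘(ℝ, E)) (hmem y hy)
    rw [(extChartAt 𝓘(ℝ, E) p).right_inv hy] at this
    exact this
  have h4 := e.mk_symm (b := (extChartAt 𝓘(ℝ, E) p).symm y) (hmem y hy) v
  rw [← h3, Bundle.Trivialization.symmL_apply e (hmem y hy)]
  exact h4

variable {J : Set ℝ}
  {g : ℝ → Π p : M, TangentSpace 𝓘(ℝ, E) p →L[ℝ] TangentSpace 𝓘(ℝ, E) p →L[ℝ] ℝ}

theorem IsSmoothMetricFamily.contDiffOn_chartFamily_apply (hg : IsSmoothMetricFamily J g) (p : M)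
    (u v : E) :
    ContDiffOn ℝ ∞ (fun x => chartFamily g p x u v) (J ×ˢ (extChartAt 𝓘(ℝ, E) p).target) := by
  have hs : ContMDiffOn 𝓘(ℝ, ℝ × E) (𝓘(ℝ, ℝ).prod 𝓘(ℝ, E)) ∞
      (fun x : ℝ × E => (x.1, (extChartAt 𝓘(ℝ, E) p).symm x.2))
      (J ×ˢ (extChartAt 𝓘(ℝ, E) p).target) :=
    contDiff_fst.contMDiff.contMDiffOn.prodMk
      ((contMDiffOn_extChartAt_symm (I := 𝓘(ℝ, E)) (n := ∞) p).comp
        contDiff_snd.contMDiff.contMDiffOn fun x hx => hx.2)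
  have hψ := hg.smooth.comp hs fun x hx => ⟨hx.1, mem_univ _⟩
  have hf : ∀ w : E, ContMDiffOn 𝓘(ℝ, ℝ × E) (𝓘(ℝ, E).prod 𝓘(ℝ, E)) ∞
      (fun x : ℝ × E => Bundle.TotalSpace.mk' E (E := fun q : M => TangentSpace 𝓘(ℝ, E) q)
        ((extChartAt 𝓘(ℝ, E) p).symm x.2) (chartFrame 𝓘(ℝ, E) p x.2 w))
      (J ×ˢ (extChartAt 𝓘(ℝ, E) p).target) := fun w =>
    (contMDiffOn_chartFrame p w).comp contDiff_snd.contMDiff.contMDiffOn fun x hx => hx.2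
  intro x hx
  have h1 : ContMDiffWithinAt 𝓘(ℝ, ℝ × E) (𝓘(ℝ, E).prod 𝓘(ℝ)) ∞
      (fun x : ℝ × E => Bundle.TotalSpace.mk' ℝ (E := Bundle.Trivial M ℝ)
        ((extChartAt 𝓘(ℝ, E) p).symm x.2)
        (g x.1 ((extChartAt 𝓘(ℝ, E) p).symm x.2) (chartFrame 𝓘(ℝ, E) p x.2 u)
          (chartFrame 𝓘(ℝ, E) p x.2 v)))
      (J ×ˢ (extChartAt 𝓘(ℝ, E) p).target) x :=
    ContMDiffWithinAt.clm_bundle_apply₂ (F₁ := E) (F₂ := E) (hψ x hx) (hf u x hx) (hf v x hx)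
  simp only [Bundle.contMDiffWithinAt_totalSpace] at h1
  exact h1.2.contDiffWithinAt

theorem IsSmoothMetricFamily.chartFamily_symm (hg : IsSmoothMetricFamily J g) (p : M) {x : ℝ × E}
    (hx : x.1 ∈ J) (u v : E) : chartFamily g p x u v = chartFamily g p x v u :=
  hg.symm x.1 hx ((extChartAt 𝓘(ℝ, E) p).symm x.2) (chartFrame 𝓘(ℝ, E) p x.2 u)
    (chartFrame 𝓘(ℝ, E) p x.2 v)

theorem IsSmoothMetricFamily.chartFamily_nondegenerate (hg : IsSmoothMetricFamily J g) (p : M)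
    {x : ℝ × E} (hx : x ∈ J ×ˢ (extChartAt 𝓘(ℝ, E) p).target) (u : E)
    (hu : ∀ v, chartFamily g p x u v = 0) : u = 0 := by
  have hD := isInvertible_chartFrame 𝓘(ℝ, E) p hx.2
  have h0 : chartFrame 𝓘(ℝ, E) p x.2 u = 0 := by
    refine hg.nondegenerate x.1 hx.1 ((extChartAt 𝓘(ℝ, E) p).symm x.2) _ fun w => ?_
    obtain ⟨v, rfl⟩ := hD.surjective w
    exact hu v
  exact hD.injective (h0.trans (map_zero _).symm)

/-- A smooth family of metrics, read in a chart. -/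
theorem IsSmoothMetricFamily.isChartFamily [FiniteDimensional ℝ E] (hg : IsSmoothMetricFamily J g)
    (hJ : UniqueDiffOn ℝ J) (p : M) :
    IsChartFamily J (extChartAt 𝓘(ℝ, E) p).target (chartFamily g p) where
  uniqueDiffOn := hJ
  isOpen := isOpen_extChartAt_target p
  contDiffOn := contDiffOn_clm_apply.2 fun u => contDiffOn_clm_apply.2 fun v =>
    hg.contDiffOn_chartFamily_apply p u v
  symm _ hx := hg.chartFamily_symm p hx.1
  nondegenerate _ hx := hg.chartFamily_nondegenerate p hx

end Smoothness

/-! ### The geometric objects on the cylinder and their chart expressions -/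

section Locality

variable {F : Type*} [NormedAddCommGroup F] [NormedSpace ℝ F]

/-- Outside the target of a chart the metric read in that chart is a junk value, so the metric of
the cylinder has the form `dt² + h_t` only locally; this and the next lemma say that this
suffices. -/
theorem christoffel_eventuallyEq {G G' : F → F →L[ℝ] F →L[ℝ] ℝ} {y : F}
    (h : G =ᶠ[nhds y] G') (S : Set F) : christoffel G S =ᶠ[nhds y] christoffel G' S := by
  filter_upwards [h.eventuallyEq_nhds] with z hz
  simp only [christoffel, hz.fderivWithin_eq_of_nhds, hz.eq_of_nhds]

theorem chartCurvature_congr {G G' : F → F →L[ℝ] F →L[ℝ] ℝ} {y : F}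
    (h : G =ᶠ[nhds y] G') (S : Set F) : chartCurvature G S y = chartCurvature G' S y := by
  have h1 := christoffel_eventuallyEq h S
  simp only [chartCurvature, h1.fderivWithin_eq_of_nhds, h1.eq_of_nhds]

theorem trace_conj_inverse {D A : F →L[ℝ] F} [FiniteDimensional ℝ F] (hD : D.IsInvertible) :
    LinearMap.trace ℝ F ((D.inverse ∘L A ∘L D : F →L[ℝ] F) : F →ₗ[ℝ] F)
      = LinearMap.trace ℝ F (A : F →ₗ[ℝ] F) := by
  have h1 : ((D.inverse ∘L A ∘L D : F →L[ℝ] F) : F →ₗ[ℝ] F)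
      = (D.inverse : F →ₗ[ℝ] F) ∘ₗ ((A : F →ₗ[ℝ] F) ∘ₗ (D : F →ₗ[ℝ] F)) := rfl
  have h2 : ((A : F →ₗ[ℝ] F) ∘ₗ (D : F →ₗ[ℝ] F)) ∘ₗ (D.inverse : F →ₗ[ℝ] F) = A := by
    ext u
    simp [hD.self_apply_inverse]
  rw [h1, LinearMap.trace_comp_comm', h2]

end Locality

section Bridge

variable {E : Type*} [NormedAddCommGroup E] [NormedSpace ℝ E]
  {M : Type*} [TopologicalSpace M] [ChartedSpace E M]
  {J : Set ℝ}
  {g : ℝ → Π p : M, TangentSpace 𝓘(ℝ, E) p →L[ℝ] TangentSpace 𝓘(ℝ, E) p →L[ℝ] ℝ}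

/-- The point `(t, φ p)` of `ℝ × E` corresponding to `(t, p)` in the chart `φ` at `p`. -/
def chartPoint (t : ℝ) (p : M) : ℝ × E := (t, extChartAt 𝓘(ℝ, E) p p)

theorem chartPoint_mem {t : ℝ} (ht : t ∈ J) (p : M) :
    chartPoint t p ∈ J ×ˢ (extChartAt 𝓘(ℝ, E) p).target :=
  ⟨ht, mem_extChartAt_target p⟩

/-- The equation is stated in the model space `E`, to which `TangentSpace` unfolds, as are the
other identifications of geometric objects with their chart expressions. -/
theorem curvature_slice (g : ℝ → Π p : M, TangentSpace 𝓘(ℝ, E) p →L[ℝ]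
    TangentSpace 𝓘(ℝ, E) p →L[ℝ] ℝ) (t : ℝ) (p : M) :
    @Eq (E →L[ℝ] E →L[ℝ] E →L[ℝ] E) (curvature 𝓘(ℝ, E) (g t) univ p)
      (sliceCurvature (chartFamily g p) (chartPoint t p)) := by
  have h1 : (curvature 𝓘(ℝ, E) (g t) univ p : E →L[ℝ] E →L[ℝ] E →L[ℝ] E)
      = chartCurvature (chartBilin 𝓘(ℝ, E) (g t) p) (chartSet 𝓘(ℝ, E) (univ : Set M) p)
        (extChartAt 𝓘(ℝ, E) p p) := rfl
  refine h1.trans ?_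
  rw [chartSet_univ, modelWithCornersSelf_coe, range_id]
  rfl

variable [IsManifold 𝓘(ℝ, E) ∞ M]

theorem chartFamily_self (g : ℝ → Π p : M, TangentSpace 𝓘(ℝ, E) p →L[ℝ]
    TangentSpace 𝓘(ℝ, E) p →L[ℝ] ℝ) (t : ℝ) (p : M) :
    @Eq (E →L[ℝ] E →L[ℝ] ℝ) (chartFamily g p (chartPoint t p)) (g t p) :=
  chartBilin_self 𝓘(ℝ, E) (g t) p

theorem chartBilin_cylinder_eventuallyEq (g : ℝ → Π p : M, TangentSpace 𝓘(ℝ, E) p →L[ℝ]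
    TangentSpace 𝓘(ℝ, E) p →L[ℝ] ℝ) (t : ℝ) (p : M) :
    chartBilin (𝓘(ℝ, ℝ).prod 𝓘(ℝ, E)) (cylinderMetric g) (t, p)
      =ᶠ[nhds (chartPoint t p)] fun x => cylinderForm (chartFamily g p x) := by
  have h1 : (univ : Set ℝ) ×ˢ (extChartAt 𝓘(ℝ, E) p).target ∈ nhds (chartPoint t p) :=
    (isOpen_univ.prod (isOpen_extChartAt_target p)).mem_nhds ⟨mem_univ _, mem_extChartAt_target p⟩
  filter_upwards [h1] with x hx
  exact chartBilin_cylinder g (t, p) hx.2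

theorem curvature_cylinder (J : Set ℝ) (g : ℝ → Π p : M, TangentSpace 𝓘(ℝ, E) p →L[ℝ]
    TangentSpace 𝓘(ℝ, E) p →L[ℝ] ℝ) (t : ℝ) (p : M) :
    @Eq (ℝ × E →L[ℝ] ℝ × E →L[ℝ] ℝ × E →L[ℝ] ℝ × E)
      (curvature (𝓘(ℝ, ℝ).prod 𝓘(ℝ, E)) (cylinderMetric g) (J ×ˢ univ) (t, p))
      (cylinderCurvature J (chartFamily g p) (chartPoint t p)) := by
  have h1 : (curvature (𝓘(ℝ, ℝ).prod 𝓘(ℝ, E)) (cylinderMetric g) (J ×ˢ univ) (t, p) :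
      ℝ × E →L[ℝ] ℝ × E →L[ℝ] ℝ × E →L[ℝ] ℝ × E)
      = chartCurvature (chartBilin (𝓘(ℝ, ℝ).prod 𝓘(ℝ, E)) (cylinderMetric g) (t, p))
        (chartSet (𝓘(ℝ, ℝ).prod 𝓘(ℝ, E)) (J ×ˢ (univ : Set M)) (t, p))
        (extChartAt (𝓘(ℝ, ℝ).prod 𝓘(ℝ, E)) (t, p) (t, p)) := rfl
  refine h1.trans ?_
  rw [chartSet_cylinder, extChartAt_cylinder_apply]
  exact chartCurvature_congr (chartBilin_cylinder_eventuallyEq g t p) _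

theorem covDeriv_nu (J : Set ℝ) (g : ℝ → Π p : M, TangentSpace 𝓘(ℝ, E) p →L[ℝ]
    TangentSpace 𝓘(ℝ, E) p →L[ℝ] ℝ) (t : ℝ) (p : M) (u : ℝ × E) :
    @Eq (ℝ × E) (covDeriv (𝓘(ℝ, ℝ).prod 𝓘(ℝ, E)) (cylinderMetric g) (J ×ˢ univ) nu (t, p) u)
      (cylinderChristoffel J (chartFamily g p) (chartPoint t p) u (1, 0)) := by
  have h1 : (covDeriv (𝓘(ℝ, ℝ).prod 𝓘(ℝ, E)) (cylinderMetric g) (J ×ˢ univ) nu (t, p) u : ℝ × E)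
      = chartCovDeriv (chartBilin (𝓘(ℝ, ℝ).prod 𝓘(ℝ, E)) (cylinderMetric g) (t, p))
        (chartSet (𝓘(ℝ, ℝ).prod 𝓘(ℝ, E)) (J ×ˢ (univ : Set M)) (t, p))
        (chartField (𝓘(ℝ, ℝ).prod 𝓘(ℝ, E)) (nu (E := E) (M := M)) (t, p))
        (extChartAt (𝓘(ℝ, ℝ).prod 𝓘(ℝ, E)) (t, p) (t, p)) u := rfl
  refine h1.trans ?_
  rw [chartSet_cylinder, extChartAt_cylinder_apply]
  have hG := christoffel_eventuallyEq (chartBilin_cylinder_eventuallyEq g t p) (J ×ˢ univ)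
  have hν : chartField (𝓘(ℝ, ℝ).prod 𝓘(ℝ, E)) (nu (E := E) (M := M)) (t, p)
      =ᶠ[nhds (chartPoint t p)] fun _ => ((1, 0) : ℝ × E) := by
    have h1 : (univ : Set ℝ) ×ˢ (extChartAt 𝓘(ℝ, E) p).target ∈ nhds (chartPoint t p) :=
      (isOpen_univ.prod (isOpen_extChartAt_target p)).mem_nhds
        ⟨mem_univ _, mem_extChartAt_target p⟩
    filter_upwards [h1] with x hx
    exact chartField_nu (t, p) hx.2
  have h2 : chartCovDeriv (chartBilin (𝓘(ℝ, ℝ).prod 𝓘(ℝ, E)) (cylinderMetric g) (t, p))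
      (J ×ˢ univ) (chartField (𝓘(ℝ, ℝ).prod 𝓘(ℝ, E)) (nu (E := E) (M := M)) (t, p))
      (chartPoint t p) u
      = cylinderChristoffel J (chartFamily g p) (chartPoint t p) u (1, 0) := by
    rw [chartCovDeriv, hν.fderivWithin_eq_of_nhds, hν.eq_of_nhds, hG.eq_of_nhds]
    simp [cylinderChristoffel]
  exact h2

theorem weingarten_eq (J : Set ℝ) (g : ℝ → Π p : M, TangentSpace 𝓘(ℝ, E) p →L[ℝ]
    TangentSpace 𝓘(ℝ, E) p →L[ℝ] ℝ) (t : ℝ) (p : M) :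
    @Eq (E →L[ℝ] E) (weingarten J g t p)
      (chartWeingarten J (chartFamily g p) (chartPoint t p)) := by
  refine ContinuousLinearMap.ext fun u => ?_
  exact (congrArg (fun w : ℝ × E => -w.2) (covDeriv_nu J g t p (0, u))).trans
    (chartWeingarten_apply J (chartFamily g p) (chartPoint t p) u).symm

theorem gDot_eq (J : Set ℝ) (g : ℝ → Π p : M, TangentSpace 𝓘(ℝ, E) p →L[ℝ]
    TangentSpace 𝓘(ℝ, E) p →L[ℝ] ℝ) (t : ℝ) (p : M) :
    @Eq (E →L[ℝ] E →L[ℝ] ℝ) (gDot J g t p) (chartDot J (chartFamily g p) (chartPoint t p)) := by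
  have h1 : (fun s => (g s p : E →L[ℝ] E →L[ℝ] ℝ))
      = fun s => chartFamily g p (s, extChartAt 𝓘(ℝ, E) p p) :=
    funext fun s => (chartFamily_self g s p).symm
  exact congrArg (fun f : ℝ → (E →L[ℝ] E →L[ℝ] ℝ) => derivWithin f J t) h1

theorem gDDot_eq (J : Set ℝ) (g : ℝ → Π p : M, TangentSpace 𝓘(ℝ, E) p →L[ℝ]
    TangentSpace 𝓘(ℝ, E) p →L[ℝ] ℝ) (t : ℝ) (p : M) :
    @Eq (E →L[ℝ] E →L[ℝ] ℝ) (gDDot J g t p) (chartDDot J (chartFamily g p) (chartPoint t p)) := by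
  have h1 : (fun s => (gDot J g s p : E →L[ℝ] E →L[ℝ] ℝ))
      = fun s => chartDot J (chartFamily g p) (s, extChartAt 𝓘(ℝ, E) p p) :=
    funext fun s => gDot_eq J g s p
  exact congrArg (fun f : ℝ → (E →L[ℝ] E →L[ℝ] ℝ) => derivWithin f J t) h1

variable [FiniteDimensional ℝ E]

/-- At each point this is the chart formula in the chart at that point. -/
theorem IsSmoothMetricFamily.metric_weingarten (hg : IsSmoothMetricFamily J g)
    (hJ : UniqueDiffOn ℝ J) {t : ℝ} (ht : t ∈ J) (p : M) (u v : TangentSpace 𝓘(ℝ, E) p) :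
    g t p (weingarten J g t p u) v = -(1 / 2) * gDot J g t p u v := by
  have h1 := (hg.isChartFamily hJ p).metric_chartWeingarten (chartPoint_mem ht p) u v
  rw [chartFamily_self, ← gDot_eq, ← weingarten_eq] at h1
  exact h1

theorem IsSmoothMetricFamily.hasDerivWithinAt (hg : IsSmoothMetricFamily J g)
    (hJ : UniqueDiffOn ℝ J) {t : ℝ} (ht : t ∈ J) (p : M) :
    HasDerivWithinAt (F := E →L[ℝ] E →L[ℝ] ℝ) (fun s => g s p) (gDot J g t p) J t := by
  have H := hg.isChartFamily hJ p
  have hx := chartPoint_mem (E := E) ht p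
  have h1 := hasDerivWithinAt_slice_fst
    (H.differentiableWithinAt_of_contDiffOn hx H.contDiffOn).hasFDerivWithinAt
  rw [← H.chartDot_eq hx, ← gDot_eq] at h1
  have h2 : (fun s => (g s p : E →L[ℝ] E →L[ℝ] ℝ))
      = fun s => chartFamily g p (s, extChartAt 𝓘(ℝ, E) p p) :=
    funext fun s => (chartFamily_self g s p).symm
  rw [h2]
  exact h1

/-- The derivative of the metric read in the chart is the derivative of the metric in the chart. -/
theorem IsSmoothMetricFamily.chartBilin_gDot (hg : IsSmoothMetricFamily J g)
    (hJ : UniqueDiffOn ℝ J) {t : ℝ} (ht : t ∈ J) (p : M) {y : E}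
    (hy : y ∈ (extChartAt 𝓘(ℝ, E) p).target) :
    chartBilin 𝓘(ℝ, E) (gDot J g t) p y = chartDot J (chartFamily g p) (t, y) := by
  have H := hg.isChartFamily hJ p
  have hx : ((t, y) : ℝ × E) ∈ J ×ˢ (extChartAt 𝓘(ℝ, E) p).target := ⟨ht, hy⟩
  refine ContinuousLinearMap.ext fun u => ContinuousLinearMap.ext fun v => ?_
  have h1 := hasDerivWithinAt_slice_fst
    (H.differentiableWithinAt_of_contDiffOn hx H.contDiffOn).hasFDerivWithinAt
  rw [← H.chartDot_eq hx] at h1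
  have h2 := (h1.clm_apply (hasDerivWithinAt_const t J u)).clm_apply (hasDerivWithinAt_const t J v)
  let k : ℝ → E →L[ℝ] E →L[ℝ] ℝ := fun s => g s ((extChartAt 𝓘(ℝ, E) p).symm y)
  let k' : E →L[ℝ] E →L[ℝ] ℝ := gDot J g t ((extChartAt 𝓘(ℝ, E) p).symm y)
  let D : E →L[ℝ] E := chartFrame 𝓘(ℝ, E) p y
  have hk : HasDerivWithinAt k k' J t := hg.hasDerivWithinAt hJ ht ((extChartAt 𝓘(ℝ, E) p).symm y)
  have h3 := (hk.clm_apply (hasDerivWithinAt_const t J (D u))).clm_apply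
    (hasDerivWithinAt_const t J (D v))
  -- `h2` and `h3` both differentiate `s ↦ g_s(D u, D v)` at the point `q` with coordinates `y`.
  have h4 := (hJ t ht).eq_deriv _ h3 h2
  simp only [map_zero, add_zero] at h4
  exact h4

/-- The Weingarten map at `q` is defined through the chart at `q`. Read in the chart at `p` it is
the Weingarten map of that chart, because both satisfy `h(W u, v) = -1/2 ḣ(u, v)`. -/
theorem IsSmoothMetricFamily.chartEnd_weingarten (hg : IsSmoothMetricFamily J g)
    (hJ : UniqueDiffOn ℝ J) {t : ℝ} (ht : t ∈ J) (p : M) {y : E}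
    (hy : y ∈ (extChartAt 𝓘(ℝ, E) p).target) :
    chartEnd 𝓘(ℝ, E) (weingarten J g t) p y = chartWeingarten J (chartFamily g p) (t, y) := by
  have H := hg.isChartFamily hJ p
  have hx : ((t, y) : ℝ × E) ∈ J ×ˢ (extChartAt 𝓘(ℝ, E) p).target := ⟨ht, hy⟩
  have hD := isInvertible_chartFrame 𝓘(ℝ, E) p hy
  refine ContinuousLinearMap.ext fun u => H.eq_of_forall_apply_eq hx fun v => ?_
  rw [H.metric_chartWeingarten hx, ← hg.chartBilin_gDot hJ ht p hy]
  have h1 : chartFrame 𝓘(ℝ, E) p y (chartEnd 𝓘(ℝ, E) (weingarten J g t) p y u)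
      = weingarten J g t ((extChartAt 𝓘(ℝ, E) p).symm y) (chartFrame 𝓘(ℝ, E) p y u) :=
    hD.self_apply_inverse _
  have h2 : chartFamily g p (t, y) (chartEnd 𝓘(ℝ, E) (weingarten J g t) p y u) v
      = g t ((extChartAt 𝓘(ℝ, E) p).symm y)
        (chartFrame 𝓘(ℝ, E) p y (chartEnd 𝓘(ℝ, E) (weingarten J g t) p y u))
        (chartFrame 𝓘(ℝ, E) p y v) := rfl
  rw [h2, h1]
  exact hg.metric_weingarten hJ ht _ _ _

theorem IsSmoothMetricFamily.endTrace_weingarten (hg : IsSmoothMetricFamily J g)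
    (hJ : UniqueDiffOn ℝ J) {t : ℝ} (ht : t ∈ J) (p : M) {y : E}
    (hy : y ∈ (extChartAt 𝓘(ℝ, E) p).target) :
    endTrace (weingarten J g t ((extChartAt 𝓘(ℝ, E) p).symm y))
      = LinearMap.trace ℝ E (chartWeingarten J (chartFamily g p) (t, y) : E →ₗ[ℝ] E) := by
  rw [← hg.chartEnd_weingarten hJ ht p hy]
  exact (trace_conj_inverse (isInvertible_chartFrame 𝓘(ℝ, E) p hy)).symm

/-- The trace of the Weingarten map is differentiable, and its differential is the trace of
the derivative of the Weingarten map in the chart. -/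
theorem IsSmoothMetricFamily.hasMFDerivAt_endTrace_weingarten (hg : IsSmoothMetricFamily J g)
    (hJ : UniqueDiffOn ℝ J) {t : ℝ} (ht : t ∈ J) (p : M) :
    ∃ L : E →L[ℝ] ℝ, HasMFDerivAt 𝓘(ℝ, E) 𝓘(ℝ, ℝ) (fun q : M => endTrace (weingarten J g t q)) p L ∧
      ∀ u : E, L u = LinearMap.trace ℝ E ((fderivWithin ℝ (chartWeingarten J (chartFamily g p))
        (J ×ˢ univ) (chartPoint t p) (0, u) : E →L[ℝ] E) : E →ₗ[ℝ] E) := by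
  have H := hg.isChartFamily hJ p
  have hx := chartPoint_mem (E := E) ht p
  let tr : (E →L[ℝ] E) →L[ℝ] ℝ := LinearMap.toContinuousLinearMap
    (LinearMap.trace ℝ E ∘ₗ ContinuousLinearMap.coeLM ℝ)
  have h1 := hasFDerivAt_slice_snd hx.1
    (H.differentiableWithinAt_chartWeingarten hx).hasFDerivWithinAt
  have h2 := (tr.hasFDerivAt.comp (extChartAt 𝓘(ℝ, E) p p) h1).hasMFDerivAt
  have h3 : HasMFDerivAt 𝓘(ℝ, E) 𝓘(ℝ, E) (extChartAt 𝓘(ℝ, E) p) p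
      (ContinuousLinearMap.id ℝ E) := by
    have h4 := (mdifferentiableAt_extChartAt (I := 𝓘(ℝ, E)) (mem_chart_source E p)).hasMFDerivAt
    rw [mfderiv_extChartAt_self] at h4
    exact h4
  have h5 := h2.comp p h3
  refine ⟨_, h5.congr_of_eventuallyEq ?_, fun u => rfl⟩
  filter_upwards [extChartAt_source_mem_nhds (I := 𝓘(ℝ, E)) p] with q hq
  have h6 := hg.endTrace_weingarten hJ ht p ((extChartAt 𝓘(ℝ, E) p).map_source hq)
  rw [(extChartAt 𝓘(ℝ, E) p).left_inv hq] at h6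
  exact h6

theorem IsSmoothMetricFamily.covDerivBilin_gDot (hg : IsSmoothMetricFamily J g)
    (hJ : UniqueDiffOn ℝ J) {t : ℝ} (ht : t ∈ J) (p : M) (u v w : E) :
    covDerivBilin 𝓘(ℝ, E) (g t) univ (gDot J g t) p u v w
      = chartCovDerivBilin (fun y => chartFamily g p (t, y)) univ
        (fun y => chartDot J (chartFamily g p) (t, y)) (extChartAt 𝓘(ℝ, E) p p) u v w := by
  have h1 : covDerivBilin 𝓘(ℝ, E) (g t) univ (gDot J g t) p u v w
      = chartCovDerivBilin (fun y => chartFamily g p (t, y))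
        (chartSet 𝓘(ℝ, E) (univ : Set M) p) (chartBilin 𝓘(ℝ, E) (gDot J g t) p)
        (extChartAt 𝓘(ℝ, E) p p) u v w := rfl
  have h2 : chartBilin 𝓘(ℝ, E) (gDot J g t) p =ᶠ[nhds (extChartAt 𝓘(ℝ, E) p p)]
      fun y => chartDot J (chartFamily g p) (t, y) := by
    filter_upwards [extChartAt_target_mem_nhds (I := 𝓘(ℝ, E)) p] with y hy
      using hg.chartBilin_gDot hJ ht p hy
  rw [h1, chartSet_univ, modelWithCornersSelf_coe, range_id, chartCovDerivBilin,
    h2.fderivWithin_eq_of_nhds, h2.eq_of_nhds]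
  rfl

theorem IsSmoothMetricFamily.divergence_weingarten (hg : IsSmoothMetricFamily J g)
    (hJ : UniqueDiffOn ℝ J) {t : ℝ} (ht : t ∈ J) (p : M) :
    @Eq E (divergence 𝓘(ℝ, E) (g t) univ (weingarten J g t) p)
      (metricContraction (chartFamily g p (chartPoint t p))
        (chartCovDerivEnd (fun y => chartFamily g p (t, y)) univ
          (fun y => chartWeingarten J (chartFamily g p) (t, y)) (extChartAt 𝓘(ℝ, E) p p))) := by
  have h1 : (divergence 𝓘(ℝ, E) (g t) univ (weingarten J g t) p : E)
      = metricContraction (F := E) (G := E) (g t p)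
        (chartCovDerivEnd (fun y => chartFamily g p (t, y))
        (chartSet 𝓘(ℝ, E) (univ : Set M) p) (chartEnd 𝓘(ℝ, E) (weingarten J g t) p)
        (extChartAt 𝓘(ℝ, E) p p)) := rfl
  have h2 : chartEnd 𝓘(ℝ, E) (weingarten J g t) p =ᶠ[nhds (extChartAt 𝓘(ℝ, E) p p)]
      fun y => chartWeingarten J (chartFamily g p) (t, y) := by
    filter_upwards [extChartAt_target_mem_nhds (I := 𝓘(ℝ, E)) p] with y hy
      using hg.chartEnd_weingarten hJ ht p hy
  rw [h1, chartSet_univ, modelWithCornersSelf_coe, range_id, chartFamily_self]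
  congr 1
  funext u v
  rw [chartCovDerivEnd, chartCovDerivEnd, h2.fderivWithin_eq_of_nhds, h2.eq_of_nhds]

end Bridge

/-! ### Ricci and scalar curvature, and the formulas of the generalized cylinder -/

section Invariants

variable {E : Type*} [NormedAddCommGroup E] [NormedSpace ℝ E]
  {M : Type*} [TopologicalSpace M] [ChartedSpace E M]

theorem ricci_slice (g : ℝ → Π p : M, TangentSpace 𝓘(ℝ, E) p →L[ℝ]
    TangentSpace 𝓘(ℝ, E) p →L[ℝ] ℝ) (t : ℝ) (p : M) (u v : E) :
    ricci 𝓘(ℝ, E) (g t) univ p u v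
      = chartRicci (fun y => chartFamily g p (t, y)) univ (extChartAt 𝓘(ℝ, E) p p) u v :=
  congrArg (fun K : E →L[ℝ] E →L[ℝ] E →L[ℝ] E => LinearMap.trace ℝ E
    (((K.flip u).flip v : E →L[ℝ] E) : E →ₗ[ℝ] E)) (curvature_slice g t p)

theorem endTrace_eq {p : M} (A : TangentSpace 𝓘(ℝ, E) p →L[ℝ] TangentSpace 𝓘(ℝ, E) p)
    {B : E →L[ℝ] E} (h : @Eq (E →L[ℝ] E) A B) :
    endTrace A = LinearMap.trace ℝ E (B : E →ₗ[ℝ] E) :=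
  congrArg (fun C : E →L[ℝ] E => LinearMap.trace ℝ E (C : E →ₗ[ℝ] E)) h

variable [IsManifold 𝓘(ℝ, E) ∞ M]

theorem ricci_cylinder (J : Set ℝ) (g : ℝ → Π p : M, TangentSpace 𝓘(ℝ, E) p →L[ℝ]
    TangentSpace 𝓘(ℝ, E) p →L[ℝ] ℝ) (t : ℝ) (p : M) (u v : ℝ × E) :
    ricci (𝓘(ℝ, ℝ).prod 𝓘(ℝ, E)) (cylinderMetric g) (J ×ˢ univ) (t, p) u v
      = cylinderRicci J (chartFamily g p) (chartPoint t p) u v :=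
  congrArg (fun K : ℝ × E →L[ℝ] ℝ × E →L[ℝ] ℝ × E →L[ℝ] ℝ × E => LinearMap.trace ℝ (ℝ × E)
    (((K.flip u).flip v : ℝ × E →L[ℝ] ℝ × E) : ℝ × E →ₗ[ℝ] ℝ × E)) (curvature_cylinder J g t p)

theorem cylinderMetric_eq (g : ℝ → Π p : M, TangentSpace 𝓘(ℝ, E) p →L[ℝ]
    TangentSpace 𝓘(ℝ, E) p →L[ℝ] ℝ) (t : ℝ) (p : M) :
    @Eq (ℝ × E →L[ℝ] ℝ × E →L[ℝ] ℝ) (cylinderMetric g (t, p))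
      (cylinderForm (chartFamily g p (chartPoint t p))) :=
  congrArg cylinderForm (chartFamily_self g t p).symm

variable [FiniteDimensional ℝ E]

theorem scalarCurvature_cylinder (J : Set ℝ) (g : ℝ → Π p : M, TangentSpace 𝓘(ℝ, E) p →L[ℝ]
    TangentSpace 𝓘(ℝ, E) p →L[ℝ] ℝ) (t : ℝ) (p : M) :
    scalarCurvature (𝓘(ℝ, ℝ).prod 𝓘(ℝ, E)) (cylinderMetric g) (J ×ˢ univ) (t, p)
      = metricContraction (cylinderForm (chartFamily g p (chartPoint t p)))
        (fun u v => cylinderRicci J (chartFamily g p) (chartPoint t p) u v) :=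
  congrArg₂ (metricContraction (F := ℝ × E) (G := ℝ)) (cylinderMetric_eq g t p)
    (funext fun u => funext fun v => ricci_cylinder J g t p u v)

theorem scalarCurvature_slice (g : ℝ → Π p : M, TangentSpace 𝓘(ℝ, E) p →L[ℝ]
    TangentSpace 𝓘(ℝ, E) p →L[ℝ] ℝ) (t : ℝ) (p : M) :
    scalarCurvature 𝓘(ℝ, E) (g t) univ p = metricContraction (chartFamily g p (chartPoint t p))
      (fun u v => chartRicci (fun y => chartFamily g p (t, y)) univ
        (extChartAt 𝓘(ℝ, E) p p) u v) :=
  congrArg₂ (metricContraction (F := E) (G := ℝ)) (chartFamily_self g t p).symm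
    (funext fun u => funext fun v => ricci_slice g t p u v)

theorem metricTrace_gDDot (J : Set ℝ) (g : ℝ → Π p : M, TangentSpace 𝓘(ℝ, E) p →L[ℝ]
    TangentSpace 𝓘(ℝ, E) p →L[ℝ] ℝ) (t : ℝ) (p : M) :
    metricTrace 𝓘(ℝ, E) (g t) p (fun X Y => gDDot J g t p X Y)
      = metricContraction (chartFamily g p (chartPoint t p))
        (fun u v => chartDDot J (chartFamily g p) (chartPoint t p) u v) :=
  congrArg₂ (fun (k b : E →L[ℝ] E →L[ℝ] ℝ) => metricContraction k (fun u v => b u v))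
    (chartFamily_self g t p).symm (gDDot_eq J g t p)

end Invariants

end GeneralizedCylinder

end

open GeneralizedCylinder in
theorem mainTheorem7
    {E : Type*} [NormedAddCommGroup E] [NormedSpace ℝ E] [FiniteDimensional ℝ E]
    {M : Type*} [TopologicalSpace M] [ChartedSpace E M] [IsManifold 𝓘(ℝ, E) ∞ M]
    (J : Set ℝ) (hJ : J.OrdConnected) (hJ' : J.Nontrivial)
    (g : ℝ → Π p : M, TangentSpace 𝓘(ℝ, E) p →L[ℝ] TangentSpace 𝓘(ℝ, E) p →L[ℝ] ℝ)
    (hg : IsSmoothMetricFamily J g) (t : ℝ) (ht : t ∈ J) (p : M) :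
    -- the point `z = (t, p)` of `Z = J × M`, the metrics of `Z` and `M_t`, and their curvatures
    let z : ℝ × M := (t, p)
    let IZ := 𝓘(ℝ, ℝ).prod 𝓘(ℝ, E)
    let Z : Set (ℝ × M) := J ×ˢ univ
    let gZ := cylinderMetric g
    let RZ := curvature IZ gZ Z z
    let RM := curvature 𝓘(ℝ, E) (g t) univ p
    let ricZ := ricci IZ gZ Z z
    let ricM := ricci 𝓘(ℝ, E) (g t) univ p
    let tan := tangential (E := E) z
    let ν := nu (E := E) z
    let W := weingarten J g t p
    let dg := gDot J g t p
    let ddg := gDDot J g t p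
    -- `W(X) = - ∇_X ν` is tangential to `M_t`
    (∀ X, tan (W X) = -covDeriv IZ gZ Z nu z (tan X)) ∧
    -- the Weingarten map
    (∀ X Y, g t p (W X) Y = -(1 / 2) * dg X Y) ∧
    -- the curvature tensor
    (∀ U V X Y, gZ z (RZ (tan U) (tan V) (tan X)) (tan Y) =
      g t p (RM U V X) Y + 1 / 4 * (dg U X * dg V Y - dg U Y * dg V X)) ∧
    (∀ X Y U, gZ z (RZ (tan X) (tan Y) (tan U)) ν =
      1 / 2 * (covDerivBilin 𝓘(ℝ, E) (g t) univ (gDot J g t) p Y X U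
        - covDerivBilin 𝓘(ℝ, E) (g t) univ (gDot J g t) p X Y U)) ∧
    (∀ X Y, gZ z (RZ (tan X) ν ν) (tan Y) = -(1 / 2) * (ddg X Y + dg (W X) Y)) ∧
    -- the Ricci curvature
    ricZ ν ν = endTrace (W ∘L W) -
      1 / 2 * metricTrace 𝓘(ℝ, E) (g t) p (fun X Y => ddg X Y) ∧
    MDifferentiableAt 𝓘(ℝ, E) 𝓘(ℝ, ℝ) (fun q : M => endTrace (weingarten J g t q)) p ∧
    (∀ X, ricZ (tan X) ν =
      mvfderiv 𝓘(ℝ, E) (fun q : M => endTrace (weingarten J g t q)) p X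
        - g t p (divergence 𝓘(ℝ, E) (g t) univ (weingarten J g t) p) X) ∧
    (∀ X Y, ricZ (tan X) (tan Y) = ricM X Y + 2 * g t p (W X) (W Y)
      - endTrace W * g t p (W X) Y - 1 / 2 * ddg X Y) ∧
    -- the scalar curvature
    scalarCurvature IZ gZ Z z = scalarCurvature 𝓘(ℝ, E) (g t) univ p
      + 3 * endTrace (W ∘L W) - endTrace W ^ 2
      - metricTrace 𝓘(ℝ, E) (g t) p (fun X Y => ddg X Y) := by
  have hJu : UniqueDiffOn ℝ J :=
    uniqueDiffOn_convex hJ.convex (hJ.convex.nontrivial_iff_nonempty_interior.1 hJ')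
  have H := hg.isChartFamily hJu p
  have hx := chartPoint_mem (E := E) ht p
  have hg0 := chartFamily_self g t p
  have hGZ := cylinderMetric_eq g t p
  have hRZ := curvature_cylinder J g t p
  have hRM := curvature_slice g t p
  have hW := weingarten_eq J g t p
  have hd := gDot_eq J g t p
  have hdd := gDDot_eq J g t p
  have hW2 : @Eq (E →L[ℝ] E) (weingarten J g t p ∘L weingarten J g t p)
      (chartWeingarten J (chartFamily g p) (chartPoint t p) ∘L
        chartWeingarten J (chartFamily g p) (chartPoint t p)) :=
    congrArg (fun C : E →L[ℝ] E => C ∘L C) hW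
  obtain ⟨L, hL, hL'⟩ := hg.hasMFDerivAt_endTrace_weingarten hJu ht p
  -- The geometric objects at `(t, p)` and their expressions in the chart agree as (multi)linear
  -- maps of `E`, to which `TangentSpace` unfolds; each formula is proved for arbitrary maps
  -- equal to the chart expressions and then applied to the geometric objects.
  set h := chartFamily g p
  set x := chartPoint (E := E) t p
  intro z IZ Z gZ RZ RM ricZ ricM tan ν W dg ddg
  refine ⟨fun X => ?_, hg.metric_weingarten hJu ht p, fun U V X Y => ?_, fun X Y U => ?_,
    fun X Y => ?_, ?_, hL.mdifferentiableAt, fun X => ?_, fun X Y => ?_, ?_⟩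
  · have key : ∀ (W' : E →L[ℝ] E) (N : ℝ × E), W' = chartWeingarten J h x →
        ∀ X : E, N = cylinderChristoffel J h x (0, X) (1, 0) → ((0, W' X) : ℝ × E) = -N := by
      rintro _ _ rfl X rfl
      ext
      · simp [H.cylinderChristoffel_fst hx]
      · simp [chartWeingarten_apply]
    exact key _ _ hW X (covDeriv_nu J g t p (0, X))
  · have key : ∀ (k : E →L[ℝ] E →L[ℝ] ℝ) (kZ : ℝ × E →L[ℝ] ℝ × E →L[ℝ] ℝ)
        (KZ : ℝ × E →L[ℝ] ℝ × E →L[ℝ] ℝ × E →L[ℝ] ℝ × E) (K : E →L[ℝ] E →L[ℝ] E →L[ℝ] E)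
        (d : E →L[ℝ] E →L[ℝ] ℝ), h x = k → kZ = cylinderForm (h x) →
        KZ = cylinderCurvature J h x → K = sliceCurvature h x → d = chartDot J h x →
        ∀ U V X Y : E, kZ (KZ (0, U) (0, V) (0, X)) (0, Y)
          = k (K U V X) Y + 1 / 4 * (d U X * d V Y - d U Y * d V X) := by
      rintro _ _ _ _ _ rfl rfl rfl rfl rfl U V X Y
      rw [cylinderForm_apply, H.cylinderCurvature_tangential_snd hx]
      simp [H.metric_chartWeingarten hx]
      ring
    exact key _ _ _ _ _ hg0 hGZ hRZ hRM hd U V X Y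
  · have key : ∀ (kZ : ℝ × E →L[ℝ] ℝ × E →L[ℝ] ℝ)
        (KZ : ℝ × E →L[ℝ] ℝ × E →L[ℝ] ℝ × E →L[ℝ] ℝ × E), kZ = cylinderForm (h x) →
        KZ = cylinderCurvature J h x → ∀ (X Y U : E) (a b : ℝ),
        a = chartCovDerivBilin (fun y => h (x.1, y)) univ (fun y => chartDot J h (x.1, y))
          x.2 Y X U →
        b = chartCovDerivBilin (fun y => h (x.1, y)) univ (fun y => chartDot J h (x.1, y))
          x.2 X Y U →
        kZ (KZ (0, X) (0, Y) (0, U)) (1, 0) = 1 / 2 * (a - b) := by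
      rintro _ _ rfl rfl X Y U _ _ rfl rfl
      rw [← H.cylinderCurvature_tangential_fst hx]
      simp
    exact key _ _ hGZ hRZ X Y U _ _ (hg.covDerivBilin_gDot hJu ht p Y X U)
      (hg.covDerivBilin_gDot hJu ht p X Y U)
  · have key : ∀ (kZ : ℝ × E →L[ℝ] ℝ × E →L[ℝ] ℝ)
        (KZ : ℝ × E →L[ℝ] ℝ × E →L[ℝ] ℝ × E →L[ℝ] ℝ × E) (W' : E →L[ℝ] E)
        (d dd : E →L[ℝ] E →L[ℝ] ℝ), kZ = cylinderForm (h x) →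
        KZ = cylinderCurvature J h x → W' = chartWeingarten J h x → d = chartDot J h x →
        dd = chartDDot J h x → ∀ X Y : E, kZ (KZ (0, X) (1, 0) (1, 0)) (0, Y)
          = -(1 / 2) * (dd X Y + d (W' X) Y) := by
      rintro _ _ _ _ _ rfl rfl rfl rfl rfl X Y
      rw [cylinderForm_apply, H.cylinderCurvature_normal_normal hx]
      simp [H.metric_fderivWithin_chartWeingarten hx, ← H.chartDDot_eq hx, ← H.chartDot_eq hx,
        H.metric_chartWeingarten hx]
      ring
    exact key _ _ _ _ _ hGZ hRZ hW hd hdd X Y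
  · refine (ricci_cylinder J g t p (1, 0) (1, 0)).trans ?_
    refine (H.cylinderRicci_normal_normal hx).trans ?_
    rw [metricTrace_gDDot]
    exact congrArg (fun a : ℝ => a - _) (endTrace_eq _ hW2).symm
  · have key : ∀ (k : E →L[ℝ] E →L[ℝ] ℝ) (D : E), h x = k →
        D = metricContraction (h x) (chartCovDerivEnd (fun y => h (x.1, y)) univ
          (fun y => chartWeingarten J h (x.1, y)) x.2) → ∀ (X : E) (c : ℝ), c = L X →
        cylinderRicci J h x (0, X) (1, 0) = c - k D X := by
      rintro _ _ rfl rfl X _ rfl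
      rw [hL', H.cylinderRicci_tangential_normal hx]
    exact (ricci_cylinder J g t p (0, X) (1, 0)).trans
      (key _ _ hg0 (hg.divergence_weingarten hJu ht p) X _
        (congrArg (fun A : E →L[ℝ] ℝ => A X) hL.mfderiv))
  · have key : ∀ (k : E →L[ℝ] E →L[ℝ] ℝ) (W' : E →L[ℝ] E)
        (dd : E →L[ℝ] E →L[ℝ] ℝ) (c r : ℝ), h x = k → W' = chartWeingarten J h x →
        dd = chartDDot J h x →
        c = LinearMap.trace ℝ E (chartWeingarten J h x : E →ₗ[ℝ] E) →
        r = chartRicci (fun y => h (x.1, y)) univ x.2 X Y →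
        cylinderRicci J h x (0, X) (0, Y)
          = r + 2 * k (W' X) (W' Y) - c * k (W' X) Y - 1 / 2 * dd X Y := by
      rintro _ _ _ _ _ rfl rfl rfl rfl rfl
      exact H.cylinderRicci_tangential hx X Y
    exact (ricci_cylinder J g t p (0, X) (0, Y)).trans
      (key _ _ _ _ _ hg0 hW hdd (endTrace_eq _ hW) (ricci_slice g t p X Y))
  · refine (scalarCurvature_cylinder J g t p).trans ?_
    have key : ∀ a b c d : ℝ,
        a = metricContraction (h x)
          (fun u v => chartRicci (fun y => h (x.1, y)) univ x.2 u v) →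
        b = LinearMap.trace ℝ E ((chartWeingarten J h x ∘L chartWeingarten J h x : E →L[ℝ] E)
          : E →ₗ[ℝ] E) →
        c = LinearMap.trace ℝ E (chartWeingarten J h x : E →ₗ[ℝ] E) →
        d = metricContraction (h x) (fun u v => chartDDot J h x u v) →
        metricContraction (cylinderForm (h x)) (fun A B => cylinderRicci J h x A B)
          = a + 3 * b - c ^ 2 - d := by
      rintro _ _ _ _ rfl rfl rfl rfl
      exact H.scalar_cylinder hx
    exact key _ _ _ _ (scalarCurvature_slice g t p) (endTrace_eq _ hW2) (endTrace_eq _ hW)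
      (metricTrace_gDDot J g t p)
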